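/- An outerplanar drawing of a graph $G$ is a drawing in which the vertices are placed at distinct points of a circle and the edges are drawn as straight chords, no more than two edges crossing at any single point. A crossing is a pair of distinct edges that meet at a common interior point, and the outerplanar crossing number $\nu_1(G)$ is the minimum number of crossings over all outerplanar drawings of $G$. Let $K(p^{(1)},m^{(n)})$ denote the complete multipartite graph with one partite set of $p$ vertices and $n$ partite sets of $m$ vertices each. Theorem. Let $m,n,p$ be nonnegative integers (partite sets may be empty) such that $mn\mid p$. Then the minimum defining $\nu_1(K(p^{(1)},m^{(n)}))$ is attained and $$\nu_1(K(p^{(1)},m^{(n)}))=\phi(m,n,p)-\frac{1}{12}m^2n^2+\frac{1}{12}p^2,$$ where $$\begin{aligned}\phi(m,n,p)={}&\tfrac{1}{24}m^4n^4+\tfrac1{12}m^2n^3-\tfrac1{12}m^4n^3-\tfrac14m^3n^3+\tfrac12m^3n^2+\tfrac1{24}m^4n^2-\tfrac14m^3n\\&+\tfrac16m^2n^2p^2-\tfrac14p^2mn-\tfrac34m^2n^2p+\tfrac1{12}mnp+\tfrac12m^2np-\tfrac16m^3n^2p+\tfrac16m^3n^3p+\tfrac16mn^2p.\end{aligned}$$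 -/

import Mathlib

/-- An outerplanar drawing of `G`: the vertices are placed at distinct points of a circle (the unit
circle of `ℂ`) and each edge is drawn as the straight chord between its endpoints, in such a way
that no three edges pass through a common interior point. -/
structure OuterplanarDrawing {V : Type*} (G : SimpleGraph V) where
  /-- the position of each vertex on the circle -/
  pos : V → Circle
  pos_injective : Function.Injective pos
  no_triple : ∀ u₁ v₁ u₂ v₂ u₃ v₃ : V, G.Adj u₁ v₁ → G.Adj u₂ v₂ → G.Adj u₃ v₃ →
    s(u₁, v₁) ≠ s(u₂, v₂) → s(u₁, v₁) ≠ s(u₃, v₃) → s(u₂, v₂) ≠ s(u₃, v₃) →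
    ∀ z : ℂ, z ∈ openSegment ℝ (pos u₁ : ℂ) (pos v₁ : ℂ) →
      z ∈ openSegment ℝ (pos u₂ : ℂ) (pos v₂ : ℂ) →
      z ∉ openSegment ℝ (pos u₃ : ℂ) (pos v₃ : ℂ)

namespace OuterplanarDrawing

variable {V : Type*} {G : SimpleGraph V}

/-- The crossings of a drawing: the unordered pairs of distinct edges whose open chords meet.
(Distinct chords of a circle meet in at most one point, and chords with a common endpoint meet
only there, so that their open chords are disjoint.) -/
def crossings (D : OuterplanarDrawing G) : Set (Sym2 (Sym2 V)) :=
  {c | ∃ u v x y : V, G.Adj u v ∧ G.Adj x y ∧ s(u, v) ≠ s(x, y) ∧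
    (openSegment ℝ (D.pos u : ℂ) (D.pos v : ℂ) ∩
      openSegment ℝ (D.pos x : ℂ) (D.pos y : ℂ)).Nonempty ∧
    c = s(s(u, v), s(x, y))}

/-- The number of crossings of a drawing. -/
noncomputable def cr₁ (D : OuterplanarDrawing G) : ℕ := D.crossings.ncard

end OuterplanarDrawing

/-- The outerplanar crossing number: the minimum number of crossings over all outerplanar
drawings. -/
noncomputable def outerplanarCrossingNumber {V : Type*} (G : SimpleGraph V) : ℕ :=
  sInf (Set.range fun D : OuterplanarDrawing G => D.cr₁)

/-- `K(a^(m), b^(n))`: the complete multipartite graph with `m` parts of size `a` and `n` parts of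
size `b`. -/
abbrev multipartiteK (a m b n : ℕ) :
    SimpleGraph (Σ i : Fin m ⊕ Fin n, Fin (Sum.elim (fun _ => a) (fun _ => b) i)) :=
  SimpleGraph.completeMultipartiteGraph
    fun i : Fin m ⊕ Fin n => Fin (Sum.elim (fun _ => a) (fun _ => b) i)

/-- The polynomial `φ(m, n, p)`. -/
def crossingPhi (m n p : ℚ) : ℚ :=
  1 / 24 * m ^ 4 * n ^ 4 + 1 / 12 * m ^ 2 * n ^ 3 - 1 / 12 * m ^ 4 * n ^ 3
    - 1 / 4 * m ^ 3 * n ^ 3 + 1 / 2 * m ^ 3 * n ^ 2 + 1 / 24 * m ^ 4 * n ^ 2 - 1 / 4 * m ^ 3 * n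
    + 1 / 6 * m ^ 2 * n ^ 2 * p ^ 2 - 1 / 4 * p ^ 2 * m * n - 3 / 4 * m ^ 2 * n ^ 2 * p
    + 1 / 12 * m * n * p + 1 / 2 * m ^ 2 * n * p - 1 / 6 * m ^ 3 * n ^ 2 * p
    + 1 / 6 * m ^ 3 * n ^ 3 * p + 1 / 6 * m * n ^ 2 * p

/-! Points on a circle are in convex position, so two chords cross exactly when their endpoints
alternate. A drawing is therefore a cyclic word in the partite classes, and its crossings are the
alternating quadruples both of whose diagonals join different colours (`cr₁_eq_card_crossingQuads`).
Conversely every word is realised by a drawing with no three concurrent edges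
(`exists_drawing_of_enumeration`), so the problem is purely combinatorial.

Twice the number of crossings is twice the number of all quadruples minus a weighted sum of
separation sums, each counting how often pairs of one colour are separated by pairs with two
prescribed colours (`two_mul_card_crossingQuads`). A quadruple with two monochromatic diagonals is
shared between them with weights adding up to 1.

Minimising crossings thus means maximising separations. Some separation sums depend only on the
class sizes. The others are constants minus nonnegative excesses. For two small classes seen from a
vertex outside both, a potential function telescoped around the circle gives an excess that vanishes
when the classes alternate (`sum_alternating`). For one class against pairs from another set of
vertices, the excess is a sum of squared deviations from uniform spacing (`sum_separated`). The
constants add up to the formula, which gives the lower bound.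

All excesses vanish at once for the word that runs through the small classes cyclically, `m` times,
with `k = p / (mn)` vertices of the large class after each small vertex. Divisibility makes `k` an
integer. -/

/-! ### Weights along an arc of a cyclic word -/

/-- The total weight of the first `t` positions. -/
def prefixWeight (f : ℕ → ℚ) (t : ℕ) : ℚ := ∑ s ∈ Finset.range t, f s

/-- The total weight of the half-open cyclic arc from `v` to `y` in a word of length `N`. -/
def arcWeight (N : ℕ) (f : ℕ → ℚ) (v y : ℕ) : ℚ :=
  prefixWeight f y - prefixWeight f v + if y < v then prefixWeight f N else 0

/-- `f` takes only the values `0` and `1`. -/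
def IsIndicator (f : ℕ → ℚ) : Prop := ∀ t, f t = 0 ∨ f t = 1

theorem prefixWeight_succ (f : ℕ → ℚ) (t : ℕ) :
    prefixWeight f (t + 1) = prefixWeight f t + f t := Finset.sum_range_succ _ _

@[simp] theorem prefixWeight_zero (f : ℕ → ℚ) : prefixWeight f 0 = 0 := rfl

@[simp] theorem arcWeight_self (N : ℕ) (f : ℕ → ℚ) (v : ℕ) : arcWeight N f v v = 0 := by
  simp [arcWeight]

theorem arcWeight_add_swap (N : ℕ) (f : ℕ → ℚ) {v y : ℕ} (h : v ≠ y) :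
    arcWeight N f v y + arcWeight N f y v = prefixWeight f N := by
  unfold arcWeight
  rcases lt_or_gt_of_ne h with h | h
  · simp only [h, h.not_gt, if_true, if_false]; ring
  · simp only [h, h.not_gt, if_true, if_false]; ring

theorem IsIndicator.exists_int {f : ℕ → ℚ} (hf : IsIndicator f) (t : ℕ) :
    ∃ z : ℤ, prefixWeight f t = z := by
  induction t with
  | zero => exact ⟨0, by simp⟩
  | succ t ih =>
    obtain ⟨z, hz⟩ := ih
    rcases hf t with h | h
    · exact ⟨z, by rw [prefixWeight_succ, hz, h, add_zero]⟩
    · exact ⟨z + 1, by rw [prefixWeight_succ, hz, h]; push_cast; rfl⟩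

theorem IsIndicator.exists_int_arc {f : ℕ → ℚ} (hf : IsIndicator f) (N v y : ℕ) :
    ∃ z : ℤ, arcWeight N f v y = z := by
  obtain ⟨a, ha⟩ := hf.exists_int y
  obtain ⟨b, hb⟩ := hf.exists_int v
  obtain ⟨d, hd⟩ := hf.exists_int N
  unfold arcWeight
  split_ifs
  · exact ⟨a - b + d, by rw [ha, hb, hd]; push_cast; rfl⟩
  · exact ⟨a - b, by rw [ha, hb]; push_cast; ring⟩

/-- Telescoping once around a cyclic word, starting at `v`. -/
theorem sum_arcWeight_telescope {N v : ℕ} (hv : v ≤ N) (f g : ℕ → ℚ) (φ : ℚ → ℚ → ℚ) :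
    ∑ y ∈ Finset.range N, (φ (arcWeight N f v y + f y) (arcWeight N g v y + g y)
      - φ (arcWeight N f v y) (arcWeight N g v y))
      = φ (prefixWeight f N) (prefixWeight g N) - φ 0 0 := by
  -- The walk starts at `v` and wraps at `N`. On each of the two stretches the arc weight is a
  -- prefix weight up to a constant, and the boundary terms at the wrap cancel.
  rw [← Finset.sum_range_add_sum_Ico _ hv]
  set ψ₁ : ℕ → ℚ := fun y => φ (prefixWeight f y - prefixWeight f v + prefixWeight f N)
    (prefixWeight g y - prefixWeight g v + prefixWeight g N) with hψ₁
  set ψ₂ : ℕ → ℚ := fun y => φ (prefixWeight f y - prefixWeight f v)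
    (prefixWeight g y - prefixWeight g v) with hψ₂
  have h1 : ∀ y ∈ Finset.range v, (φ (arcWeight N f v y + f y) (arcWeight N g v y + g y)
      - φ (arcWeight N f v y) (arcWeight N g v y)) = ψ₁ (y + 1) - ψ₁ y := by
    intro y hy
    have hy' : y < v := Finset.mem_range.1 hy
    simp only [hψ₁, arcWeight, hy', if_true, prefixWeight_succ]
    congr 2 <;> ring
  have h2 : ∀ y ∈ Finset.Ico v N, (φ (arcWeight N f v y + f y) (arcWeight N g v y + g y)
      - φ (arcWeight N f v y) (arcWeight N g v y)) = ψ₂ (y + 1) - ψ₂ y := by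
    intro y hy
    have hy' : ¬ y < v := not_lt.2 (Finset.mem_Ico.1 hy).1
    simp only [hψ₂, arcWeight, hy', if_false, prefixWeight_succ, add_zero]
    congr 2 <;> ring
  rw [Finset.sum_congr rfl h1, Finset.sum_congr rfl h2, Finset.sum_range_sub,
    Finset.sum_Ico_sub _ hv]
  simp only [hψ₁, hψ₂, sub_self, zero_add, prefixWeight_zero, zero_sub, neg_add_eq_sub]
  ring

/-- Summing a function of the rank over the marked positions. -/
theorem sum_rank {N v : ℕ} (hv : v ≤ N) {f : ℕ → ℚ} (hf : IsIndicator f) (φ P : ℚ → ℚ)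
    (h : ∀ x, φ (x + 1) - φ x = P x) :
    ∑ y ∈ Finset.range N, f y * P (arcWeight N f v y) = φ (prefixWeight f N) - φ 0 := by
  rw [← sum_arcWeight_telescope hv f f (fun x _ => φ x)]
  refine Finset.sum_congr rfl fun y _ => ?_
  rcases hf y with h0 | h0
  · simp [h0]
  · simp [h0, h]

/-- Triples of `f` seen from an unmarked position. -/
theorem sum_rank_mul_rank {N v : ℕ} (hv : v ≤ N) {f : ℕ → ℚ} (hf : IsIndicator f) {m : ℚ}
    (hm : prefixWeight f N = m) :
    ∑ y ∈ Finset.range N, f y * (arcWeight N f v y * (m - arcWeight N f v y - 1))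
      = m * (m - 1) * (m - 2) / 6 := by
  -- A discrete antiderivative of `x * (m - x - 1)`, built from the sums of `j` and of `j ^ 2` for
  -- `j < x`. The total is the number of triples, each counted once at its middle element as seen
  -- from `v`.
  rw [sum_rank hv hf (fun x => (m - 1) * (x * (x - 1) / 2) - x * (x - 1) * (2 * x - 1) / 6)
    (fun x => x * (m - x - 1)) (fun x => by ring), hm]
  ring

/-- Triples of `f` seen from a marked position. -/
theorem sum_rank_mul_rank_of_mem {N v : ℕ} (hv : v < N) {f : ℕ → ℚ} (hf : IsIndicator f) {m : ℚ}
    (hm : prefixWeight f N = m) (h1 : f v = 1) :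
    ∑ y ∈ Finset.range N, (if v = y then 0 else
      f y * ((arcWeight N f v y - 1) * (m - arcWeight N f v y - 1)))
      = (m - 1) * (m - 2) * (m - 3) / 6 := by
  have key := sum_rank hv.le hf
    (fun x => m * (x * (x - 1) / 2) - x * (x - 1) * (2 * x - 1) / 6 - (m - 1) * x)
    (fun x => (x - 1) * (m - x - 1)) (fun x => by ring)
  -- The term `y = v` has rank 0 and separates nothing, but the rank formula gives it the value `-(m
  -- - 1)`; it is taken out on both sides.
  rw [hm, ← Finset.add_sum_erase _ _ (Finset.mem_range.2 hv)] at key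
  rw [← Finset.add_sum_erase _ _ (Finset.mem_range.2 hv)]
  rw [Finset.sum_congr rfl (g := fun y => f y * ((arcWeight N f v y - 1) *
    (m - arcWeight N f v y - 1))) (fun y hy => if_neg (Finset.ne_of_mem_erase hy).symm)]
  simp only [arcWeight_self, h1, if_true] at key ⊢
  linear_combination key

/-- The excess of two equally frequent colours, seen from `v`, over perfect alternation. -/
def alternationExcess (N : ℕ) (f g : ℕ → ℚ) (v : ℕ) : ℚ :=
  ∑ y ∈ Finset.range N,
    (f y * ((arcWeight N f v y - arcWeight N g v y) * (arcWeight N f v y - arcWeight N g v y + 1))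
    + g y * ((arcWeight N f v y - arcWeight N g v y) *
      (arcWeight N f v y - arcWeight N g v y - 1)))

/-- Arc weights of indicators are integers, and a product of two consecutive integers is never
negative. -/
theorem alternationExcess_nonneg (N : ℕ) {f g : ℕ → ℚ} (hf : IsIndicator f) (hg : IsIndicator g)
    (v : ℕ) : 0 ≤ alternationExcess N f g v := by
  refine Finset.sum_nonneg fun y _ => ?_
  obtain ⟨a, ha⟩ := hf.exists_int_arc N v y
  obtain ⟨b, hb⟩ := hg.exists_int_arc N v y
  have h1 : 0 ≤ (a - b) * (a - b + 1) := by
    rcases le_or_gt 0 (a - b) with h | h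
    · positivity
    · exact mul_nonneg_of_nonpos_of_nonpos h.le (by omega)
  have h2 : 0 ≤ (a - b) * (a - b - 1) := by
    rcases le_or_gt (a - b) 0 with h | h
    · exact mul_nonneg_of_nonpos_of_nonpos h (by omega)
    · exact mul_nonneg h.le (by omega)
  rw [ha, hb]
  have h1' : (0 : ℚ) ≤ (a - b) * (a - b + 1) := by exact_mod_cast h1
  have h2' : (0 : ℚ) ≤ (a - b) * (a - b - 1) := by exact_mod_cast h2
  have hf0 : 0 ≤ f y := by rcases hf y with h | h <;> rw [h]; norm_num
  have hg0 : 0 ≤ g y := by rcases hg y with h | h <;> rw [h]; norm_num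
  positivity

/-- Two colours of equal multiplicity `m`, seen from a fixed position. -/
theorem sum_alternating {N v : ℕ} (hv : v ≤ N) {f g : ℕ → ℚ} (hf : IsIndicator f)
    (hg : IsIndicator g) (hfg : ∀ t, f t * g t = 0) {m : ℚ} (hfm : prefixWeight f N = m)
    (hgm : prefixWeight g N = m) :
    (∑ y ∈ Finset.range N, g y * (arcWeight N f v y * (m - arcWeight N f v y)))
      + ∑ y ∈ Finset.range N, f y * (arcWeight N g v y * (m - arcWeight N g v y))
      = (m ^ 3 - m) / 3 - alternationExcess N f g v / 2 := by
  -- The potential is chosen so that raising `A` by one adds `B * (m - B) + (A - B) * (A - B + 1) /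
  -- 2`, and symmetrically for `B`: the wanted summand plus half the excess. Its value at `(m, m)`
  -- is `(m ^ 3 - m) / 3`.
  have key := sum_arcWeight_telescope hv f g (fun A B => m * A * B - A * B ^ 2 / 2 - A ^ 2 * B / 2
    + (A ^ 3 - A) / 6 + (B ^ 3 - B) / 6)
  rw [hfm, hgm] at key
  rw [alternationExcess, ← Finset.sum_add_distrib, eq_sub_iff_add_eq, Finset.sum_div,
    ← Finset.sum_add_distrib]
  trans m * m * m - m * m ^ 2 / 2 - m ^ 2 * m / 2 + (m ^ 3 - m) / 6 + (m ^ 3 - m) / 6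
  · rw [show m * m * m - m * m ^ 2 / 2 - m ^ 2 * m / 2 + (m ^ 3 - m) / 6 + (m ^ 3 - m) / 6 =
      m * m * m - m * m ^ 2 / 2 - m ^ 2 * m / 2 + (m ^ 3 - m) / 6 + (m ^ 3 - m) / 6 -
      (m * 0 * 0 - 0 * 0 ^ 2 / 2 - 0 ^ 2 * 0 / 2 + (0 ^ 3 - 0) / 6 + (0 ^ 3 - 0) / 6) by ring,
      ← key]
    refine Finset.sum_congr rfl fun y _ => ?_
    rcases hf y with h0 | h0
    · rcases hg y with h1 | h1
      · simp [h0, h1]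
      · rw [h0, h1]; ring
    · have h1 : g y = 0 := by simpa [h0] using hfg y
      rw [h0, h1]; ring
  · ring

/-- If `f` is `k` times as frequent as `g`, the pairs of `f` separating pairs of `g` are at most as
many as for a uniform distribution. -/
theorem sum_separated {N : ℕ} {f g : ℕ → ℚ} (hg : IsIndicator g) {k M : ℚ}
    (hf : prefixWeight f N = k * M) (hgM : prefixWeight g N = M) :
    ∑ v ∈ Finset.range N, ∑ y ∈ Finset.range N,
      g v * (g y * (arcWeight N f v y * (k * M - arcWeight N f v y)))
      = k ^ 2 * M * (M ^ 3 - M) / 6 - ∑ v ∈ Finset.range N, ∑ y ∈ Finset.range N,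
      g v * (g y * ((prefixWeight f y - k * prefixWeight g y)
        - (prefixWeight f v - k * prefixWeight g v)) ^ 2) := by
  -- Since `f` has total weight `k * M`, this deviation returns to zero after a full turn, so `harc`
  -- needs no wrap-around term.
  set e : ℕ → ℚ := fun t => prefixWeight f t - k * prefixWeight g t with he
  have harc : ∀ v y, arcWeight N f v y = k * arcWeight N g v y + (e y - e v) := by
    intro v y
    simp only [arcWeight, he, hf, hgM]
    split_ifs <;> ring
  -- the antisymmetric kernel with vanishing row sums
  set w : ℕ → ℕ → ℚ := fun v y => if v = y then 0 else M - 2 * arcWeight N g v y with hw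
  have hanti : ∀ v y, w v y = - w y v := by
    intro v y
    by_cases h : v = y
    · simp [hw, h]
    · have := arcWeight_add_swap N g h
      simp only [hw, h, Ne.symm h, if_false]
      rw [hgM] at this
      linarith
  have hrow : ∀ v ∈ Finset.range N, g v * ∑ y ∈ Finset.range N, g y * w v y = 0 := by
    intro v hv
    rcases hg v with h | h
    · rw [h, zero_mul]
    -- Seen from a marked `v`, the other marked positions have ranks `1, ..., M - 1`, over which `M
    -- - 2 * x` sums to zero.
    have key := sum_rank (Finset.mem_range.1 hv).le hg (fun x => M * x - x * (x - 1))
      (fun x => M - 2 * x) (fun x => by ring)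
    rw [hgM, ← Finset.add_sum_erase _ _ hv] at key
    rw [← Finset.add_sum_erase _ _ hv,
      Finset.sum_congr rfl (g := fun y => g y * (M - 2 * arcWeight N g v y))
      (fun y hy => by simp only [hw, if_neg (Finset.ne_of_mem_erase hy).symm])]
    simp only [arcWeight_self, h, hw, if_true] at key ⊢
    linear_combination key
  have hlin1 : ∑ v ∈ Finset.range N, ∑ y ∈ Finset.range N, g v * (g y * (e v * w v y)) = 0 := by
    refine Finset.sum_eq_zero fun v hv => ?_
    rw [← mul_zero (e v), ← hrow v hv, Finset.mul_sum, Finset.mul_sum]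
    exact Finset.sum_congr rfl fun y _ => by ring
  have hlin2 : ∑ v ∈ Finset.range N, ∑ y ∈ Finset.range N, g v * (g y * (e y * w v y)) = 0 := by
    rw [Finset.sum_comm, ← neg_zero, ← hlin1, ← Finset.sum_neg_distrib]
    refine Finset.sum_congr rfl fun v _ => ?_
    rw [← Finset.sum_neg_distrib]
    refine Finset.sum_congr rfl fun y _ => ?_
    rw [hanti y v]; ring
  have hquad : ∑ v ∈ Finset.range N, ∑ y ∈ Finset.range N,
      g v * (g y * (k ^ 2 * (arcWeight N g v y * (M - arcWeight N g v y))))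
      = k ^ 2 * M * (M ^ 3 - M) / 6 := by
    have : ∀ v ∈ Finset.range N, ∑ y ∈ Finset.range N,
      g v * (g y * (k ^ 2 * (arcWeight N g v y * (M - arcWeight N g v y))))
      = g v * (k ^ 2 * (M ^ 3 - M) / 6) := by
      intro v hv
      have key := sum_rank (Finset.mem_range.1 hv).le hg
        (fun x => k ^ 2 * (M * (x * (x - 1) / 2) - x * (x - 1) * (2 * x - 1) / 6))
        (fun x => k ^ 2 * (x * (M - x))) (fun x => by ring)
      rw [← Finset.mul_sum, key, hgM]
      ring
    rw [Finset.sum_congr rfl this, ← Finset.sum_mul]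
    change prefixWeight g N * _ = _
    rw [hgM]; ring
  -- With `R` the arc weight of `g` and `d = e y - e v`, the product `(k R + d) (k M - k R - d)`
  -- splits into a term in `R`, the cross term `k d (M - 2 R)` and `-d ^ 2`. The zero diagonal of
  -- `w` is harmless because `d = 0` there.
  have hsplit : ∑ v ∈ Finset.range N, ∑ y ∈ Finset.range N,
      g v * (g y * (arcWeight N f v y * (k * M - arcWeight N f v y)))
      + ∑ v ∈ Finset.range N, ∑ y ∈ Finset.range N, g v * (g y * (e y - e v) ^ 2)
      = ∑ v ∈ Finset.range N, ∑ y ∈ Finset.range N,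
        g v * (g y * (k ^ 2 * (arcWeight N g v y * (M - arcWeight N g v y))))
      + k * (∑ v ∈ Finset.range N, ∑ y ∈ Finset.range N, g v * (g y * (e y * w v y))
        - ∑ v ∈ Finset.range N, ∑ y ∈ Finset.range N, g v * (g y * (e v * w v y))) := by
    simp only [← Finset.sum_sub_distrib, ← Finset.sum_add_distrib, Finset.mul_sum]
    refine Finset.sum_congr rfl fun v _ => Finset.sum_congr rfl fun y _ => ?_
    rw [harc]
    by_cases h : v = y
    · subst h; simp [hw]
    · simp only [hw, h, if_false]; ring
  rw [hlin1, hlin2, hquad, sub_zero, mul_zero, add_zero] at hsplit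
  exact eq_sub_of_add_eq hsplit

/-! ### Crossings of a coloured cyclic word -/

/-- The indicator of the colour `a` in the word `c`. -/
def colourInd {κ : Type*} [DecidableEq κ] (c : ℕ → κ) (a : κ) (t : ℕ) : ℚ :=
  if c t = a then 1 else 0

/-- The alternating quadruples of the word `c` of length `N` whose two diagonals are bicoloured. -/
def crossingQuads {κ : Type*} [DecidableEq κ] (N : ℕ) (c : ℕ → κ) : Finset (ℕ × ℕ × ℕ × ℕ) :=
  (Finset.range N ×ˢ Finset.range N ×ˢ Finset.range N ×ˢ Finset.range N).filter fun q =>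
    q.1 < q.2.1 ∧ q.2.1 < q.2.2.1 ∧ q.2.2.1 < q.2.2.2 ∧ c q.1 ≠ c q.2.2.1 ∧ c q.2.1 ≠ c q.2.2.2

/-- The indicator of `i < j`. -/
def ltInd (i j : ℕ) : ℚ := if i < j then 1 else 0

/-- For `u ≠ v`, the number of pairs of `f` separated by `u` and `v`. -/
def separatedPairs (N : ℕ) (f : ℕ → ℚ) (u v : ℕ) : ℚ :=
  if u = v then 0 else (arcWeight N f u v - f u) * (prefixWeight f N - arcWeight N f u v - f v)

/-- The number of pairs of colour `a` separated by ordered pairs with colours `r` and `s`. -/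
def separationSum {κ : Type*} [DecidableEq κ] (N : ℕ) (c : ℕ → κ) (a r s : κ) : ℚ :=
  ∑ u ∈ Finset.range N, ∑ v ∈ Finset.range N,
    colourInd c r u * (colourInd c s v * separatedPairs N (colourInd c a) u v)

theorem separatedPairs_comm (N : ℕ) (f : ℕ → ℚ) (u v : ℕ) :
    separatedPairs N f u v = separatedPairs N f v u := by
  unfold separatedPairs
  by_cases h : u = v
  · simp [h]
  · have := arcWeight_add_swap N f h
    rw [if_neg h, if_neg (Ne.symm h), ← this]
    ring

theorem separationSum_comm {κ : Type*} [DecidableEq κ] (N : ℕ) (c : ℕ → κ) (a r s : κ) :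
    separationSum N c a r s = separationSum N c a s r := by
  unfold separationSum
  rw [Finset.sum_comm]
  refine Finset.sum_congr rfl fun v _ => Finset.sum_congr rfl fun u _ => ?_
  rw [separatedPairs_comm]; ring

theorem colourInd_isIndicator {κ : Type*} [DecidableEq κ] (c : ℕ → κ) (a : κ) :
    IsIndicator (colourInd c a) := by
  intro t
  unfold colourInd
  split_ifs <;> simp

theorem sum_ltInd_mul_ltInd {N u v : ℕ} (hv : v ≤ N) (f : ℕ → ℚ) :
    ∑ x ∈ Finset.range N, ltInd u x * (ltInd x v * f x)
      = ltInd u v * (prefixWeight f v - prefixWeight f u - f u) := by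
  by_cases h : u < v
  · have hs : (Finset.range N).filter (fun x => u < x ∧ x < v) = Finset.Ico (u + 1) v := by
      ext x; simp only [Finset.mem_filter, Finset.mem_range, Finset.mem_Ico]; omega
    have : ∀ x ∈ Finset.range N, ltInd u x * (ltInd x v * f x)
        = if u < x ∧ x < v then f x else 0 := by
      intro x _
      unfold ltInd
      by_cases h1 : u < x <;> by_cases h2 : x < v <;> simp [h1, h2]
    rw [Finset.sum_congr rfl this, ← Finset.sum_filter, hs, Finset.sum_Ico_eq_sub _ h]
    change prefixWeight f v - prefixWeight f (u + 1) = _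
    rw [prefixWeight_succ, ltInd, if_pos h]; ring
  · rw [ltInd, if_neg h, zero_mul]
    refine Finset.sum_eq_zero fun x _ => ?_
    unfold ltInd
    by_cases h1 : u < x
    · have h2 : ¬ x < v := by omega
      simp [h2]
    · simp [h1]

theorem sum_ltInd_left {N u : ℕ} (hu : u ≤ N) (f : ℕ → ℚ) :
    ∑ y ∈ Finset.range N, ltInd y u * f y = prefixWeight f u := by
  have hs : (Finset.range N).filter (fun x => x < u) = Finset.range u := by
    ext x; simp only [Finset.mem_filter, Finset.mem_range]; omega
  rw [prefixWeight, ← hs, Finset.sum_filter]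
  exact Finset.sum_congr rfl fun x _ => by simp [ltInd]

theorem sum_ltInd_right {N v : ℕ} (hv : v < N) (f : ℕ → ℚ) :
    ∑ y ∈ Finset.range N, ltInd v y * f y = prefixWeight f N - prefixWeight f v - f v := by
  have hs : (Finset.range N).filter (fun x => v < x) = Finset.Ico (v + 1) N := by
    ext x; simp only [Finset.mem_filter, Finset.mem_range, Finset.mem_Ico]; omega
  rw [sub_sub, ← prefixWeight_succ, prefixWeight, prefixWeight,
    ← Finset.sum_Ico_eq_sub _ (Nat.succ_le_of_lt hv), ← hs, Finset.sum_filter]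
  exact Finset.sum_congr rfl fun x _ => by simp [ltInd]

/-- A separated pair has one element strictly between `u` and `v` and one outside, before `u` or
after `v`. The arc from `u` to `v` contains `u` and omits `v`, whence the corrections by `f u` and
`f v`. -/
theorem ltInd_mul_separatedPairs {N u v : ℕ} (hv : v < N) (f : ℕ → ℚ) :
    (∑ x ∈ Finset.range N, ltInd u x * (ltInd x v * f x)) *
      (∑ y ∈ Finset.range N, ltInd y u * f y + ∑ y ∈ Finset.range N, ltInd v y * f y)
      = ltInd u v * separatedPairs N f u v := by
  rw [sum_ltInd_mul_ltInd hv.le]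
  by_cases h : u < v
  · rw [sum_ltInd_left (h.trans hv).le, sum_ltInd_right hv, separatedPairs, if_neg h.ne, arcWeight,
      if_neg h.not_gt]
    ring
  · simp [ltInd, h]

/-- The number of increasing quadruples below `N`. -/
def quadTotal (N : ℕ) : ℚ :=
  ∑ i ∈ Finset.range N, ∑ j ∈ Finset.range N, ∑ k ∈ Finset.range N, ∑ l ∈ Finset.range N,
    ltInd i j * (ltInd j k * ltInd k l)

/-- Weighting by `ω` the colours of the two diagonals. -/
def diagonalWeight {κ : Type*} [DecidableEq κ] (ω : κ → κ → ℚ) (a r s : κ) : ℚ :=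
  if r = s then ω a r else 1

theorem sum_colourInd_mul {κ : Type*} [DecidableEq κ] [Fintype κ] (c : ℕ → κ) (t : ℕ)
    (g : κ → ℚ) : ∑ a, colourInd c a t * g a = g (c t) := by
  simp [colourInd, Finset.sum_ite_eq]

/-- Inclusion–exclusion on the monochromatic diagonals, where the overlap is split by `ω` instead of
being added back. -/
theorem bicoloured_diagonals {κ : Type*} [DecidableEq κ] [Fintype κ] {ω : κ → κ → ℚ}
    (hω : ∀ a b, ω a b + ω b a = 1) (c : ℕ → κ) (i j k l : ℕ) :
    (if c i ≠ c k ∧ c j ≠ c l then (1 : ℚ) else 0) = 1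
      - ∑ a, diagonalWeight ω a (c j) (c l) * (colourInd c a i * colourInd c a k)
      - ∑ a, diagonalWeight ω a (c i) (c k) * (colourInd c a j * colourInd c a l) := by
  have h1 : ∀ x y r s, ∑ a, diagonalWeight ω a r s * (colourInd c a x * colourInd c a y)
      = diagonalWeight ω (c x) r s * colourInd c (c x) y := by
    intro x y r s
    rw [← sum_colourInd_mul c x (fun a => diagonalWeight ω a r s * colourInd c a y)]
    exact Finset.sum_congr rfl fun a _ => by ring
  rw [h1, h1]
  have := hω (c i) (c j)
  unfold diagonalWeight colourInd
  by_cases hik : c i = c k <;> by_cases hjl : c j = c l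
  · rw [← hik, ← hjl]; simp; linarith
  · simp [hik, hjl, Ne.symm hjl]
  · simp [hik, hjl, Ne.symm hik]
  · simp [hik, hjl, Ne.symm hik, Ne.symm hjl]

theorem sum_inner_outer_right (N : ℕ) (f : ℕ → ℚ) (w : ℕ → ℕ → ℚ) :
    ∑ i ∈ Finset.range N, ∑ j ∈ Finset.range N, ∑ k ∈ Finset.range N, ∑ l ∈ Finset.range N,
      ltInd i j * (ltInd j k * ltInd k l) * (w i k * (f j * f l))
    = ∑ u ∈ Finset.range N, ∑ v ∈ Finset.range N, w u v *
      ((∑ x ∈ Finset.range N, ltInd u x * (ltInd x v * f x)) *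
        ∑ y ∈ Finset.range N, ltInd v y * f y) := by
  refine Finset.sum_congr rfl fun i _ => ?_
  rw [Finset.sum_comm]
  refine Finset.sum_congr rfl fun k _ => ?_
  rw [Finset.sum_mul_sum, Finset.mul_sum]
  refine Finset.sum_congr rfl fun j _ => ?_
  rw [Finset.mul_sum]
  exact Finset.sum_congr rfl fun l _ => by ring

theorem sum_inner_outer_left (N : ℕ) (f : ℕ → ℚ) (w : ℕ → ℕ → ℚ) :
    ∑ i ∈ Finset.range N, ∑ j ∈ Finset.range N, ∑ k ∈ Finset.range N, ∑ l ∈ Finset.range N,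
      ltInd i j * (ltInd j k * ltInd k l) * (w j l * (f i * f k))
    = ∑ u ∈ Finset.range N, ∑ v ∈ Finset.range N, w u v *
      ((∑ x ∈ Finset.range N, ltInd u x * (ltInd x v * f x)) *
        ∑ y ∈ Finset.range N, ltInd y u * f y) := by
  rw [Finset.sum_comm]
  refine Finset.sum_congr rfl fun j _ => ?_
  have : ∀ i ∈ Finset.range N, ∑ k ∈ Finset.range N, ∑ l ∈ Finset.range N,
      ltInd i j * (ltInd j k * ltInd k l) * (w j l * (f i * f k)) =
      ∑ l ∈ Finset.range N, ∑ k ∈ Finset.range N,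
      ltInd i j * (ltInd j k * ltInd k l) * (w j l * (f i * f k)) :=
    fun i _ => Finset.sum_comm
  rw [Finset.sum_congr rfl this, Finset.sum_comm]
  refine Finset.sum_congr rfl fun l _ => ?_
  rw [Finset.sum_mul_sum, Finset.mul_sum, Finset.sum_comm]
  refine Finset.sum_congr rfl fun k _ => ?_
  rw [Finset.mul_sum]
  exact Finset.sum_congr rfl fun i _ => by ring

theorem sum_ltInd_symm (N : ℕ) (g : ℕ → ℕ → ℚ) (hg : ∀ u v, g u v = g v u)
    (h0 : ∀ u, g u u = 0) :
    2 * ∑ u ∈ Finset.range N, ∑ v ∈ Finset.range N, ltInd u v * g u v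
      = ∑ u ∈ Finset.range N, ∑ v ∈ Finset.range N, g u v := by
  rw [two_mul]
  nth_rewrite 2 [Finset.sum_comm]
  simp only [← Finset.sum_add_distrib]
  refine Finset.sum_congr rfl fun u _ => Finset.sum_congr rfl fun v _ => ?_
  rw [hg v u]
  unfold ltInd
  rcases lt_trichotomy u v with h | h | h
  · simp [h, h.not_gt]
  · subst h; simp [h0]
  · simp [h, h.not_gt]

theorem card_crossingQuads {κ : Type*} [DecidableEq κ] (N : ℕ) (c : ℕ → κ) :
    ((crossingQuads N c).card : ℚ) = ∑ i ∈ Finset.range N, ∑ j ∈ Finset.range N,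
      ∑ k ∈ Finset.range N, ∑ l ∈ Finset.range N,
        ltInd i j * (ltInd j k * ltInd k l) * (if c i ≠ c k ∧ c j ≠ c l then (1 : ℚ) else 0) := by
  rw [crossingQuads, Finset.card_filter]
  push_cast
  rw [Finset.sum_product]
  refine Finset.sum_congr rfl fun i _ => ?_
  rw [Finset.sum_product]
  refine Finset.sum_congr rfl fun j _ => ?_
  rw [Finset.sum_product]
  refine Finset.sum_congr rfl fun k _ => Finset.sum_congr rfl fun l _ => ?_
  unfold ltInd
  by_cases h1 : i < j <;> by_cases h2 : j < k <;> by_cases h3 : k < l <;> simp [h1, h2, h3]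

/-- For a monochromatic diagonal of colour `a` the other diagonal `u < v` separates its ends; the
two positions of the outer end give the two sums in `hcomb`. The factor 2 passes from `u < v` to
ordered pairs, which are then sorted by colour. -/
theorem two_mul_card_crossingQuads {κ : Type*} [DecidableEq κ] [Fintype κ] {ω : κ → κ → ℚ}
    (hω : ∀ a b, ω a b + ω b a = 1) (N : ℕ) (c : ℕ → κ) :
    2 * ((crossingQuads N c).card : ℚ) = 2 * quadTotal N
      - ∑ a, ∑ r, ∑ s, diagonalWeight ω a r s * separationSum N c a r s := by
  have hsum : ((crossingQuads N c).card : ℚ) = quadTotal N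
      - ∑ a, ∑ u ∈ Finset.range N, ∑ v ∈ Finset.range N,
        ltInd u v * (diagonalWeight ω a (c u) (c v) * separatedPairs N (colourInd c a) u v) := by
    have hright := fun a => sum_inner_outer_right N (colourInd c a)
      (fun u v => diagonalWeight ω a (c u) (c v))
    have hleft := fun a => sum_inner_outer_left N (colourInd c a)
      (fun u v => diagonalWeight ω a (c u) (c v))
    have hcomb : ∀ a, ∑ u ∈ Finset.range N, ∑ v ∈ Finset.range N,
        ltInd u v * (diagonalWeight ω a (c u) (c v) * separatedPairs N (colourInd c a) u v)
        = (∑ i ∈ Finset.range N, ∑ j ∈ Finset.range N, ∑ k ∈ Finset.range N, ∑ l ∈ Finset.range N,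
          ltInd i j * (ltInd j k * ltInd k l) *
            (diagonalWeight ω a (c j) (c l) * (colourInd c a i * colourInd c a k)))
        + ∑ i ∈ Finset.range N, ∑ j ∈ Finset.range N, ∑ k ∈ Finset.range N, ∑ l ∈ Finset.range N,
          ltInd i j * (ltInd j k * ltInd k l) *
            (diagonalWeight ω a (c i) (c k) * (colourInd c a j * colourInd c a l)) := by
      intro a
      rw [hright, hleft, ← Finset.sum_add_distrib]
      refine Finset.sum_congr rfl fun u _ => ?_
      rw [← Finset.sum_add_distrib]
      refine Finset.sum_congr rfl fun v hv => ?_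
      have := ltInd_mul_separatedPairs (u := u) (Finset.mem_range.1 hv) (colourInd c a)
      linear_combination (-diagonalWeight ω a (c u) (c v)) * this
    rw [Finset.sum_congr rfl (fun a _ => hcomb a), card_crossingQuads, quadTotal]
    have push : ∀ G : κ → ℕ → ℕ → ℕ → ℕ → ℚ, ∑ a, ∑ i ∈ Finset.range N, ∑ j ∈ Finset.range N,
        ∑ k ∈ Finset.range N, ∑ l ∈ Finset.range N, G a i j k l =
        ∑ i ∈ Finset.range N, ∑ j ∈ Finset.range N,
        ∑ k ∈ Finset.range N, ∑ l ∈ Finset.range N, ∑ a, G a i j k l := by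
      intro G
      rw [Finset.sum_comm]
      refine Finset.sum_congr rfl fun i _ => ?_
      rw [Finset.sum_comm]
      refine Finset.sum_congr rfl fun j _ => ?_
      rw [Finset.sum_comm]
      refine Finset.sum_congr rfl fun k _ => ?_
      rw [Finset.sum_comm]
    rw [Finset.sum_add_distrib, push, push, ← sub_sub]
    simp only [← Finset.sum_sub_distrib]
    refine Finset.sum_congr rfl fun i _ => Finset.sum_congr rfl fun j _ =>
      Finset.sum_congr rfl fun k _ => Finset.sum_congr rfl fun l _ => ?_
    rw [bicoloured_diagonals hω, ← Finset.mul_sum, ← Finset.mul_sum]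
    ring
  rw [hsum, mul_sub, Finset.mul_sum]
  congr 1
  refine Finset.sum_congr rfl fun a _ => ?_
  rw [sum_ltInd_symm N (fun u v => diagonalWeight ω a (c u) (c v) *
    separatedPairs N (colourInd c a) u v)]
  · have : ∀ u v, diagonalWeight ω a (c u) (c v) * separatedPairs N (colourInd c a) u v =
        ∑ r, ∑ s, diagonalWeight ω a r s * (colourInd c r u * (colourInd c s v *
          separatedPairs N (colourInd c a) u v)) := by
      intro u v
      rw [← sum_colourInd_mul c u (fun r => diagonalWeight ω a r (c v) * _)]
      refine Finset.sum_congr rfl fun r _ => ?_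
      rw [← sum_colourInd_mul c v (fun s => diagonalWeight ω a r s * _), Finset.mul_sum]
      exact Finset.sum_congr rfl fun s _ => by ring
    have swap : ∀ G : ℕ → ℕ → κ → κ → ℚ,
        ∑ u ∈ Finset.range N, ∑ v ∈ Finset.range N, ∑ r, ∑ s, G u v r s
        = ∑ r, ∑ s, ∑ u ∈ Finset.range N, ∑ v ∈ Finset.range N, G u v r s := by
      intro G
      rw [Finset.sum_congr rfl fun u _ => Finset.sum_comm, Finset.sum_comm]
      refine Finset.sum_congr rfl fun r _ => ?_
      rw [Finset.sum_congr rfl fun u _ => Finset.sum_comm, Finset.sum_comm]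
    simp only [this, separationSum, Finset.mul_sum]
    exact swap _
  · intro u v
    rw [separatedPairs_comm]
    unfold diagonalWeight
    by_cases h : c u = c v
    · simp [h]
    · simp [h, Ne.symm h]
  · intro u
    simp [separatedPairs]

/-! ### Evaluating the separation sums -/

theorem colourInd_mul_of_ne {κ : Type*} [DecidableEq κ] (c : ℕ → κ) {a b : κ} (h : a ≠ b)
    (t : ℕ) : colourInd c a t * colourInd c b t = 0 := by
  unfold colourInd
  by_cases h1 : c t = a
  · have : c t ≠ b := h1 ▸ h
    simp [this]
  · simp [h1]

theorem separatedPairs_of_eq_zero {N : ℕ} {f : ℕ → ℚ} {u v : ℕ} (hu : f u = 0) (hv : f v = 0) :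
    separatedPairs N f u v = arcWeight N f u v * (prefixWeight f N - arcWeight N f u v) := by
  unfold separatedPairs
  split_ifs with h
  · subst h; simp
  · rw [hu, hv, sub_zero, sub_zero]

/-- From each vertex of colour `s`, every triple of colour `a` is counted once, at its middle
element, so the arrangement does not matter. -/
theorem separationSum_self_left {κ : Type*} [DecidableEq κ] (N : ℕ) (c : ℕ → κ) {a s : κ}
    (h : a ≠ s) {m : ℚ} (hm : prefixWeight (colourInd c a) N = m) :
    separationSum N c a s a
      = prefixWeight (colourInd c s) N * (m * (m - 1) * (m - 2) / 6) := by
  rw [separationSum, prefixWeight, Finset.sum_mul]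
  refine Finset.sum_congr rfl fun u hu => ?_
  rw [← Finset.mul_sum]
  rcases colourInd_isIndicator c s u with h0 | h0
  · rw [h0, zero_mul, zero_mul]
  have ha : colourInd c a u = 0 := by simpa [h0] using colourInd_mul_of_ne c h u
  rw [← sum_rank_mul_rank (Finset.mem_range.1 hu).le (colourInd_isIndicator c a) hm]
  congr 1
  refine Finset.sum_congr rfl fun v _ => ?_
  rcases colourInd_isIndicator c a v with h1 | h1
  · rw [h1, zero_mul, zero_mul]
  have huv : u ≠ v := by rintro rfl; rw [ha] at h1; exact zero_ne_one h1
  rw [separatedPairs, if_neg huv, ha, h1, hm, sub_zero]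

theorem separationSum_self {κ : Type*} [DecidableEq κ] (N : ℕ) (c : ℕ → κ) (a : κ) {m : ℚ}
    (hm : prefixWeight (colourInd c a) N = m) :
    separationSum N c a a a = m * ((m - 1) * (m - 2) * (m - 3) / 6) := by
  trans prefixWeight (colourInd c a) N * ((m - 1) * (m - 2) * (m - 3) / 6)
  swap
  · rw [hm]
  rw [separationSum, prefixWeight, Finset.sum_mul]
  refine Finset.sum_congr rfl fun u hu => ?_
  rw [← Finset.mul_sum]
  rcases colourInd_isIndicator c a u with h0 | h0
  · rw [h0, zero_mul, zero_mul]
  rw [← sum_rank_mul_rank_of_mem (Finset.mem_range.1 hu) (colourInd_isIndicator c a) hm h0]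
  congr 1
  refine Finset.sum_congr rfl fun v _ => ?_
  rcases colourInd_isIndicator c a v with h1 | h1
  · rw [h1, zero_mul, zero_mul, ite_self]
  rw [separatedPairs, h0, h1, hm, mul_ite, mul_zero]

theorem quadTotal_eq (N : ℕ) :
    quadTotal N = (N : ℚ) * (N - 1) * (N - 2) * (N - 3) / 24 := by
  -- A word with a single colour has no crossings, so the counting identity itself evaluates the
  -- total.
  have h := two_mul_card_crossingQuads (ω := fun _ _ : Unit => (1 / 2 : ℚ))
    (fun _ _ => by norm_num) N (fun _ => ())
  have hm : prefixWeight (colourInd (fun _ => ()) ()) N = N := by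
    simp [prefixWeight, colourInd]
  have h0 : (crossingQuads N (fun _ => ())).card = 0 := by simp [crossingQuads]
  simp only [Finset.univ_unique, Finset.sum_singleton, h0, PUnit.default_eq_unit, diagonalWeight,
    if_true] at h
  rw [separationSum_self N _ _ hm] at h
  push_cast at h
  linarith

theorem separationSum_add_swap {κ : Type*} [DecidableEq κ] (N : ℕ) (c : ℕ → κ) {a b r : κ}
    (hab : a ≠ b) (har : a ≠ r) (hbr : b ≠ r) {m : ℚ}
    (ha : prefixWeight (colourInd c a) N = m) (hb : prefixWeight (colourInd c b) N = m) :
    separationSum N c a r b + separationSum N c b r a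
      = prefixWeight (colourInd c r) N * ((m ^ 3 - m) / 3)
        - ∑ v ∈ Finset.range N,
          colourInd c r v * (alternationExcess N (colourInd c a) (colourInd c b) v / 2) := by
  rw [separationSum, separationSum, prefixWeight, Finset.sum_mul, ← Finset.sum_add_distrib,
    ← Finset.sum_sub_distrib]
  refine Finset.sum_congr rfl fun v hv => ?_
  rw [← Finset.mul_sum, ← Finset.mul_sum, ← mul_add, ← mul_sub]
  rcases colourInd_isIndicator c r v with h0 | h0
  · rw [h0, zero_mul, zero_mul]
  rw [← sum_alternating (Finset.mem_range.1 hv).le (colourInd_isIndicator c a)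
    (colourInd_isIndicator c b) (colourInd_mul_of_ne c hab) ha hb]
  have key : ∀ x y : κ, x ≠ y → x ≠ r → prefixWeight (colourInd c x) N = m →
      ∑ u ∈ Finset.range N, colourInd c y u * separatedPairs N (colourInd c x) v u =
      ∑ u ∈ Finset.range N, colourInd c y u * (arcWeight N (colourInd c x) v u *
        (m - arcWeight N (colourInd c x) v u)) := by
    intro x y hxy hxr hx
    refine Finset.sum_congr rfl fun u _ => ?_
    rcases colourInd_isIndicator c y u with h1 | h1
    · rw [h1, zero_mul, zero_mul]
    rw [separatedPairs_of_eq_zero _ _, hx]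
    · simpa [h0] using colourInd_mul_of_ne c hxr v
    · simpa [h1] using colourInd_mul_of_ne c hxy u
  rw [key a b hab har ha, key b a hab.symm hbr hb]

/-- The indicator of a set of colours. -/
def colourSetInd {κ : Type*} [DecidableEq κ] (c : ℕ → κ) (S : Finset κ) (t : ℕ) : ℚ :=
  if c t ∈ S then 1 else 0

theorem colourSetInd_eq_sum {κ : Type*} [DecidableEq κ] (c : ℕ → κ) (S : Finset κ) (t : ℕ) :
    colourSetInd c S t = ∑ r ∈ S, colourInd c r t := by
  simp [colourSetInd, colourInd, Finset.sum_ite_eq]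

theorem colourSetInd_isIndicator {κ : Type*} [DecidableEq κ] (c : ℕ → κ) (S : Finset κ) :
    IsIndicator (colourSetInd c S) := by
  intro t
  unfold colourSetInd
  split_ifs <;> simp

theorem prefixWeight_colourSetInd {κ : Type*} [DecidableEq κ] (c : ℕ → κ) (S : Finset κ)
    (t : ℕ) : prefixWeight (colourSetInd c S) t = ∑ r ∈ S, prefixWeight (colourInd c r) t := by
  simp only [prefixWeight, colourSetInd_eq_sum]
  exact Finset.sum_comm

/-- The squared deviation of the colour `a` from a uniform distribution among the colours `S`. -/
def uniformityExcess {κ : Type*} [DecidableEq κ] (N : ℕ) (c : ℕ → κ) (k : ℚ) (a : κ)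
    (S : Finset κ) : ℚ :=
  ∑ v ∈ Finset.range N, ∑ y ∈ Finset.range N, colourSetInd c S v * (colourSetInd c S y *
    ((prefixWeight (colourInd c a) y - k * prefixWeight (colourSetInd c S) y)
      - (prefixWeight (colourInd c a) v - k * prefixWeight (colourSetInd c S) v)) ^ 2)

theorem uniformityExcess_nonneg {κ : Type*} [DecidableEq κ] (N : ℕ) (c : ℕ → κ) (k : ℚ) (a : κ)
    (S : Finset κ) : 0 ≤ uniformityExcess N c k a S := by
  have h0 : ∀ t, 0 ≤ colourSetInd c S t := fun t => by unfold colourSetInd; split_ifs <;> simp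
  exact Finset.sum_nonneg fun v _ => Finset.sum_nonneg fun y _ =>
    mul_nonneg (h0 v) (mul_nonneg (h0 y) (sq_nonneg _))

/-- Summing over all colour pairs from `S` merges `S` into one class, to which `sum_separated`
applies. -/
theorem sum_separationSum {κ : Type*} [DecidableEq κ] (N : ℕ) (c : ℕ → κ) {a : κ} {S : Finset κ}
    (haS : a ∉ S) {k M : ℚ} (ha : prefixWeight (colourInd c a) N = k * M)
    (hS : prefixWeight (colourSetInd c S) N = M) :
    ∑ r ∈ S, ∑ s ∈ S, separationSum N c a r s
      = k ^ 2 * M * (M ^ 3 - M) / 6 - uniformityExcess N c k a S := by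
  rw [uniformityExcess, ← sum_separated (colourSetInd_isIndicator c S) ha hS]
  simp only [separationSum]
  rw [Finset.sum_congr rfl fun r _ => Finset.sum_comm, Finset.sum_comm]
  refine Finset.sum_congr rfl fun u _ => ?_
  rw [Finset.sum_congr rfl fun r _ => Finset.sum_comm, Finset.sum_comm]
  refine Finset.sum_congr rfl fun v _ => ?_
  have h0 : ∀ t, colourSetInd c S t = 1 → colourInd c a t = 0 := by
    intro t ht
    have hmem : c t ∈ S := by
      by_contra h
      simp [colourSetInd, h] at ht
    have : c t ≠ a := fun h => haS (h ▸ hmem)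
    simp [colourInd, this]
  have : ∑ r ∈ S, ∑ s ∈ S, colourInd c r u * (colourInd c s v *
      separatedPairs N (colourInd c a) u v) =
      colourSetInd c S u * (colourSetInd c S v * separatedPairs N (colourInd c a) u v) := by
    rw [colourSetInd_eq_sum, colourSetInd_eq_sum, Finset.sum_mul, Finset.sum_mul]
    simp only [Finset.mul_sum]
  rw [this]
  rcases colourSetInd_isIndicator c S u with h1 | h1
  · rw [h1, zero_mul, zero_mul]
  rcases colourSetInd_isIndicator c S v with h2 | h2
  · rw [h2, zero_mul, zero_mul]
  rw [separatedPairs_of_eq_zero (h0 u h1) (h0 v h2), ha]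

/-! ### Words with one large colour class and equal small classes -/

/-- How an alternating quadruple with two monochromatic diagonals is shared between them. -/
def shareWeight {n : ℕ} : Fin 1 ⊕ Fin n → Fin 1 ⊕ Fin n → ℚ
  | .inl _, .inl _ => 1 / 2
  | .inl _, .inr _ => 1
  | .inr _, .inl _ => 0
  | .inr _, .inr _ => 1 / 2

theorem shareWeight_add_swap {n : ℕ} (a b : Fin 1 ⊕ Fin n) :
    shareWeight a b + shareWeight b a = 1 := by
  rcases a with a | a <;> rcases b with b | b <;> norm_num [shareWeight]

/-- The small colours. -/
abbrev smallColours (n : ℕ) : Finset (Fin 1 ⊕ Fin n) :=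
  Finset.univ.map Function.Embedding.inr

theorem two_mul_sum_symm {ι : Type*} [Fintype ι] (f : ι → ι → ℚ) :
    2 * ∑ a, ∑ s, f a s = ∑ a, ∑ s, (f a s + f s a) := by
  simp only [Finset.sum_add_distrib]
  rw [two_mul]
  congr 1
  exact Finset.sum_comm

theorem sum_diag_offdiag (n : ℕ) (A B : ℚ) :
    ∑ a : Fin n, ∑ s : Fin n, (if a = s then A else B) = n * A + n * (n - 1) * B := by
  have : ∀ a s : Fin n, (if a = s then A else B) = B + if a = s then A - B else 0 := by
    intro a s; split_ifs <;> ring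
  simp only [this, Finset.sum_add_distrib]
  simp
  ring

theorem sum_triples (n : ℕ) (D E G Z : ℚ) :
    ∑ r : Fin n, ∑ a : Fin n, ∑ s : Fin n,
      (if a = r then (if s = r then Z else G) else if s = r then G else if a = s then E else D)
      = n * Z + n * (n - 1) * (2 * G) + n * (n - 1) * E + n * (n - 1) * (n - 2) * D := by
  -- Inclusion–exclusion over the coincidences; the last coefficient corrects the case `a = r = s`.
  have : ∀ r a s : Fin n,
      (if a = r then (if s = r then Z else G) else if s = r then G else if a = s then E else D)
      = D + (if a = s then E - D else 0) + (if a = r then G - D else 0)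
        + (if s = r then G - D else 0)
        + (if a = r then (if s = r then Z - E - 2 * G + 2 * D else 0) else 0) := by
    intro r a s
    by_cases h1 : a = r <;> by_cases h2 : s = r
    · have : a = s := h1.trans h2.symm
      simp only [h1, h2, if_true]; ring
    · simp only [h1, h2, if_true, if_false]; simp [Ne.symm h2]
    · simp only [h2, h1, if_true, if_false]; ring
    · simp only [h1, h2, if_false]
      by_cases h3 : a = s <;> simp [h3]
  simp only [this, Finset.sum_add_distrib]
  simp
  ring

/-- The contributions of the three kinds of excess to twice the number of crossings. -/
theorem two_mul_card_crossingQuads_eq {m n p : ℕ} {k : ℚ} (hk : (p : ℚ) = k * (m * n)) {N : ℕ}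
    (hN : N = p + m * n) (c : ℕ → Fin 1 ⊕ Fin n)
    (hP : prefixWeight (colourInd c (.inl 0)) N = p)
    (hQ : ∀ i, prefixWeight (colourInd c (.inr i)) N = m) :
    ∃ T : ℚ, 2 * ((crossingQuads N c).card : ℚ) = 2 * (crossingPhi m n p
        - 1 / 12 * (m : ℚ) ^ 2 * (n : ℚ) ^ 2 + 1 / 12 * (p : ℚ) ^ 2) + T ∧ 0 ≤ T ∧
      ((∀ i j : Fin n, i ≠ j → ∀ v < N,
          alternationExcess N (colourInd c (.inr i)) (colourInd c (.inr j)) v = 0) →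
        (∀ i j : Fin n, i ≠ j → uniformityExcess N c 1 (.inr i) {.inr j} = 0) →
        uniformityExcess N c k (.inl 0) (smallColours n) = 0 → T = 0) := by
  set H := separationSum N c with hH
  -- the excess of the pair `i`, `j`, seen from the colour `r`
  set V : Fin 1 ⊕ Fin n → Fin n → Fin n → ℚ := fun r i j => ∑ v ∈ Finset.range N,
    colourInd c r v *
      (alternationExcess N (colourInd c (.inr i)) (colourInd c (.inr j)) v / 2) with hV
  have hV0 : ∀ r i j, 0 ≤ V r i j := by
    intro r i j
    refine Finset.sum_nonneg fun v _ => mul_nonneg ?_ ?_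
    · rcases colourInd_isIndicator c r v with h | h <;> rw [h]; norm_num
    · exact div_nonneg (alternationExcess_nonneg N (colourInd_isIndicator c _)
        (colourInd_isIndicator c _) v) (by norm_num)
  set U : Fin n → Fin n → ℚ := fun i j => uniformityExcess N c 1 (.inr i) {.inr j} with hU
  have hU0 : ∀ i j, 0 ≤ U i j := fun i j => uniformityExcess_nonneg _ _ _ _ _
  have hMsum : prefixWeight (colourSetInd c (smallColours n)) N = m * n := by
    rw [prefixWeight_colourSetInd, Finset.sum_map]
    simp [hQ, mul_comm]
  have hUP0 := uniformityExcess_nonneg N c k (.inl 0) (smallColours n)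
  have hPQ := sum_separationSum N c (a := .inl 0) (S := smallColours n) (by simp)
    (hP.trans hk) hMsum
  rw [Finset.sum_map] at hPQ
  simp only [Finset.sum_map, Function.Embedding.inr_apply] at hPQ
  have hUeq : ∀ i j : Fin n, i ≠ j → H (.inr i) (.inr j) (.inr j) =
      (m : ℚ) * (m ^ 3 - m) / 6 - U i j := by
    intro i j hij
    have := sum_separationSum N c (a := .inr i) (S := {.inr j}) (k := 1) (M := m)
      (by simpa using hij) (by rw [hQ, one_mul])
      (by rw [prefixWeight_colourSetInd, Finset.sum_singleton, hQ])
    simpa using this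
  have hPP : H (.inl 0) (.inl 0) (.inl 0) = p * (((p : ℚ) - 1) * (p - 2) * (p - 3) / 6) :=
    separationSum_self N c _ hP
  have hPs : ∀ s, H (.inl 0) (.inr s) (.inl 0) = m * ((p : ℚ) * (p - 1) * (p - 2) / 6) := by
    intro s
    rw [hH, separationSum_self_left N c (by simp) hP, hQ]
  have hPs' : ∀ s, H (.inl 0) (.inl 0) (.inr s) = m * ((p : ℚ) * (p - 1) * (p - 2) / 6) := by
    intro s
    rw [← hPs s]; exact separationSum_comm _ _ _ _ _
  have hcomm : ∀ a r s, H a r s = H a s r := separationSum_comm N c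
  -- the terms with exactly one of the four vertices in the large class
  have h1P : 2 * ∑ a : Fin n, ∑ s : Fin n, H (.inr a) (.inl 0) (.inr s)
      = n * (2 * (p * ((m : ℚ) * (m - 1) * (m - 2) / 6)))
        + n * (n - 1) * (p * (((m : ℚ) ^ 3 - m) / 3))
        - ∑ a : Fin n, ∑ s : Fin n, if a = s then 0 else V (.inl 0) a s := by
    rw [two_mul_sum_symm, ← sum_diag_offdiag, ← Finset.sum_sub_distrib]
    refine Finset.sum_congr rfl fun a _ => ?_
    rw [← Finset.sum_sub_distrib]
    refine Finset.sum_congr rfl fun s _ => ?_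
    split_ifs with h
    · subst h
      rw [hH, separationSum_self_left N c (by simp) (hQ a), hP]; ring
    · rw [hH, separationSum_add_swap N c (by simpa using h) (by simp) (by simp) (hQ a) (hQ s), hP]
  -- Symmetrising in `a` and `s` brings together the two separation sums bounded by alternation when
  -- `a`, `r`, `s` are distinct. The coincidences leave size-only terms, and the uniformity excess
  -- `U` with share `1 / 2`.
  have h0P : 2 * ∑ r : Fin n, ∑ a : Fin n, ∑ s : Fin n,
      diagonalWeight shareWeight (.inr a) (.inr r) (.inr s) * H (.inr a) (.inr r) (.inr s)
      = n * (m * (((m : ℚ) - 1) * (m - 2) * (m - 3) / 6))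
        + n * (n - 1) * (2 * (m * ((m : ℚ) * (m - 1) * (m - 2) / 6)
          + 1 / 2 * ((m : ℚ) * (m ^ 3 - m) / 6)))
        + n * (n - 1) * (2 * (m * ((m : ℚ) * (m - 1) * (m - 2) / 6)))
        + n * (n - 1) * (n - 2) * (m * (((m : ℚ) ^ 3 - m) / 3))
        - ∑ r : Fin n, ∑ a : Fin n, ∑ s : Fin n,
          (if a = r then (if s = r then 0 else 1 / 2 * U s r) else
            if s = r then 1 / 2 * U a r else if a = s then 0 else V (.inr r) a s) := by
    rw [← sum_triples, Finset.mul_sum, ← Finset.sum_sub_distrib]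
    refine Finset.sum_congr rfl fun r _ => ?_
    rw [two_mul_sum_symm, ← Finset.sum_sub_distrib]
    refine Finset.sum_congr rfl fun a _ => ?_
    rw [← Finset.sum_sub_distrib]
    refine Finset.sum_congr rfl fun s _ => ?_
    have hne : ∀ {x y : Fin n}, x ≠ y → (Sum.inr x : Fin 1 ⊕ Fin n) ≠ Sum.inr y :=
      fun h h' => h (Sum.inr_injective h')
    by_cases h1 : a = r <;> by_cases h2 : s = r
    · subst h1; subst h2
      simp only [if_true, diagonalWeight, shareWeight]
      rw [hH, separationSum_self N c _ (hQ s)]; ring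
    · subst h1
      simp only [if_true, if_false, h2, diagonalWeight, shareWeight, hne (Ne.symm h2)]
      rw [hUeq s a h2, hcomm, hH, separationSum_self_left N c (hne (Ne.symm h2)) (hQ a), hQ]; ring
    · subst h2
      simp only [if_true, if_false, h1, diagonalWeight, shareWeight, hne (Ne.symm h1)]
      rw [hUeq a s h1, hcomm _ (Sum.inr s) (Sum.inr a), hH,
        separationSum_self_left N c (hne (Ne.symm h1)) (hQ s), hQ]; ring
    · simp only [if_false, h1, h2, diagonalWeight, hne (Ne.symm h1), hne (Ne.symm h2)]
      by_cases h3 : a = s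
      · subst h3
        simp only [if_true]
        rw [hH, separationSum_self_left N c (hne h1) (hQ a), hQ]; ring
      · simp only [if_false, h3]
        rw [one_mul, one_mul, hH,
          separationSum_add_swap N c (hne h3) (hne h1) (hne h2) (hQ a) (hQ s), hQ]
  have key := two_mul_card_crossingQuads (ω := shareWeight) shareWeight_add_swap N c
  have h0P' : ∑ a : Fin n, ∑ r : Fin n, ∑ s : Fin n,
      diagonalWeight shareWeight (.inr a) (.inr r) (.inr s) * H (.inr a) (.inr r) (.inr s) =
      ∑ r : Fin n, ∑ a : Fin n, ∑ s : Fin n,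
      diagonalWeight shareWeight (.inr a) (.inr r) (.inr s) * H (.inr a) (.inr r) (.inr s) :=
    Finset.sum_comm
  -- The asymmetric share pays off here: all pairs of small colours separating the large class have
  -- weight 1, even when equal, so the small classes act as one set.
  have hone : ∀ r s : Fin n,
      diagonalWeight shareWeight (.inl 0) (.inr r) (.inr s) = 1 := by
    intro r s
    unfold diagonalWeight
    split_ifs <;> rfl
  have hexp : ∑ a, ∑ r, ∑ s, diagonalWeight shareWeight a r s * H a r s
      = 1 / 2 * H (.inl 0) (.inl 0) (.inl 0)
      + ∑ s : Fin n, H (.inl 0) (.inl 0) (.inr s) + ∑ s : Fin n, H (.inl 0) (.inr s) (.inl 0)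
      + ∑ r : Fin n, ∑ s : Fin n, H (.inl 0) (.inr r) (.inr s)
      + 2 * ∑ a : Fin n, ∑ s : Fin n, H (.inr a) (.inl 0) (.inr s)
      + ∑ a : Fin n, ∑ r : Fin n, ∑ s : Fin n,
        diagonalWeight shareWeight (.inr a) (.inr r) (.inr s) *
          H (.inr a) (.inr r) (.inr s) := by
    have hsw : ∀ a s : Fin n, H (.inr a) (.inr s) (.inl 0) = H (.inr a) (.inl 0) (.inr s) :=
      fun a s => hcomm _ _ _
    simp only [Fintype.sum_sum_type, Finset.univ_unique, Finset.sum_singleton,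
      Fin.default_eq_zero, hone, one_mul, Finset.sum_add_distrib]
    simp only [diagonalWeight, shareWeight, if_true, reduceCtorEq, if_false, one_mul, zero_mul,
      hsw, Finset.sum_const_zero]
    ring
  have hNq : (N : ℚ) = p + m * n := by rw [hN]; push_cast; rfl
  rw [hexp, h0P', hPQ, quadTotal_eq, hPP, hNq] at key
  simp only [hPs, hPs', Finset.sum_const, Finset.card_univ, Fintype.card_fin, nsmul_eq_mul]
    at key
  refine ⟨uniformityExcess N c k (.inl 0) (smallColours n)
    + (∑ a : Fin n, ∑ s : Fin n, if a = s then 0 else V (.inl 0) a s)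
    + 1 / 2 * ∑ r : Fin n, ∑ a : Fin n, ∑ s : Fin n,
      (if a = r then (if s = r then 0 else 1 / 2 * U s r) else
        if s = r then 1 / 2 * U a r else if a = s then 0 else V (.inr r) a s), ?_, ?_, ?_⟩
  -- After `p = k * (m * n)` is substituted, the constants match as polynomials in `k`, `m`, `n`.
  · unfold crossingPhi
    rw [hk] at key h1P ⊢
    linear_combination key - h1P - 1 / 2 * h0P
  · refine add_nonneg (add_nonneg hUP0 ?_) (mul_nonneg (by norm_num) ?_)
    · refine Finset.sum_nonneg fun a _ => Finset.sum_nonneg fun s _ => ?_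
      split_ifs
      exacts [le_rfl, hV0 _ _ _]
    · refine Finset.sum_nonneg fun r _ => Finset.sum_nonneg fun a _ =>
        Finset.sum_nonneg fun s _ => ?_
      have := hU0 s r
      have := hU0 a r
      have := hV0 (.inr r) a s
      split_ifs <;> linarith
  · intro hA hB hC
    have hVz : ∀ r i j, i ≠ j → V r i j = 0 := by
      intro r i j hij
      refine Finset.sum_eq_zero fun v hv => ?_
      rw [hA i j hij v (Finset.mem_range.1 hv)]; simp
    rw [hC, Finset.sum_eq_zero, Finset.sum_eq_zero]
    · simp
    · refine fun r _ => Finset.sum_eq_zero fun a _ => Finset.sum_eq_zero fun s _ => ?_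
      split_ifs with h1 h2 h2 h3
      · rfl
      · rw [hU]; simp only; rw [hB s r h2, mul_zero]
      · rw [hU]; simp only; rw [hB a r h1, mul_zero]
      · rfl
      · exact hVz _ _ _ h3
    · refine fun a _ => Finset.sum_eq_zero fun s _ => ?_
      split_ifs with h
      · rfl
      · exact hVz _ _ _ h

/-! ### An optimal word -/

/-- Small classes in cyclic order, with `k` vertices of the large class after each vertex. -/
def uniformWord (n k : ℕ) [NeZero n] (t : ℕ) : Fin 1 ⊕ Fin n :=
  if k + 1 ∣ t then .inr (Fin.ofNat n (t / (k + 1))) else .inl 0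

theorem uniformWord_eq_inr_iff {n k : ℕ} [NeZero n] {t : ℕ} {i : Fin n} :
    uniformWord n k t = .inr i ↔ k + 1 ∣ t ∧ (t / (k + 1)) % n = i := by
  unfold uniformWord
  split_ifs with h
  · simp [h, Fin.ext_iff]
  · simp [h]

theorem uniformWord_eq_inl_iff {n k : ℕ} [NeZero n] {t : ℕ} :
    uniformWord n k t = .inl 0 ↔ ¬ k + 1 ∣ t := by
  unfold uniformWord
  split_ifs with h <;> simp [h]

/-- The number of multiples of `k + 1` below `t`. -/
def blockCount (k t : ℕ) : ℕ := (t + k) / (k + 1)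

@[simp] theorem blockCount_zero (k : ℕ) : blockCount k 0 = 0 := by
  simp [blockCount, Nat.div_eq_of_lt]

theorem blockCount_succ (k t : ℕ) :
    blockCount k (t + 1) = blockCount k t + if k + 1 ∣ t then 1 else 0 := by
  unfold blockCount
  rw [add_right_comm, Nat.succ_div]
  congr 1
  simp only [add_assoc, Nat.dvd_add_self_right]

theorem blockCount_of_dvd {k t : ℕ} (h : k + 1 ∣ t) : blockCount k t = t / (k + 1) := by
  obtain ⟨q, rfl⟩ := h
  unfold blockCount
  rw [Nat.mul_add_div (Nat.succ_pos k), Nat.mul_div_cancel_left _ (Nat.succ_pos k),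
    Nat.div_eq_of_lt (Nat.lt_succ_self k), add_zero]

/-- The recursion for the number of integers below `s` congruent to `i` modulo `n`, namely `s / n`,
plus one if `i < s % n`. -/
theorem div_add_ite_succ {n : ℕ} (s : ℕ) (i : Fin n) :
    (s + 1) / n + (if (i : ℕ) < (s + 1) % n then 1 else 0)
      = s / n + (if (i : ℕ) < s % n then 1 else 0) + if s % n = i then 1 else 0 := by
  have hn : 0 < n := i.pos
  have hi := i.isLt
  have hw : s % n < n := Nat.mod_lt _ hn
  have hs : n * (s / n) + s % n = s := Nat.div_add_mod s n
  set u := s / n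
  set w := s % n
  by_cases h : w + 1 < n
  · have h1 : (s + 1) / n = u := by
      rw [← hs, add_assoc, Nat.mul_add_div hn, Nat.div_eq_of_lt h, add_zero]
    have h2 : (s + 1) % n = w + 1 := by
      rw [← hs, add_assoc, Nat.mul_add_mod, Nat.mod_eq_of_lt h]
    rw [h1, h2]
    split_ifs <;> omega
  · have hwn : w + 1 = n := by omega
    have h1 : (s + 1) / n = u + 1 := by
      rw [← hs, add_assoc, Nat.mul_add_div hn, hwn, Nat.div_self hn]
    have h2 : (s + 1) % n = 0 := by
      rw [← hs, add_assoc, Nat.mul_add_mod, hwn, Nat.mod_self]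
    rw [h1, h2]
    split_ifs <;> omega

theorem prefixWeight_uniformWord_inr (n k : ℕ) [NeZero n] (i : Fin n) (t : ℕ) :
    prefixWeight (colourInd (uniformWord n k) (.inr i)) t
      = ((blockCount k t / n + if (i : ℕ) < blockCount k t % n then 1 else 0 : ℕ) : ℚ) := by
  induction t with
  | zero => simp
  | succ t ih =>
    rw [prefixWeight_succ, ih, blockCount_succ]
    unfold colourInd
    by_cases h : k + 1 ∣ t
    · rw [if_pos h, div_add_ite_succ, Nat.cast_add _ (if _ = _ then 1 else 0)]
      congr 1
      simp only [uniformWord_eq_inr_iff, h, true_and, blockCount_of_dvd h]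
      split_ifs <;> simp
    · have : uniformWord n k t ≠ .inr i := fun h' => h (uniformWord_eq_inr_iff.1 h').1
      rw [if_neg this, if_neg h, add_zero, add_zero]

theorem prefixWeight_uniformWord_inl (n k : ℕ) [NeZero n] (t : ℕ) :
    prefixWeight (colourInd (uniformWord n k) (.inl 0)) t = t - blockCount k t := by
  induction t with
  | zero => simp
  | succ t ih =>
    rw [prefixWeight_succ, ih, blockCount_succ]
    unfold colourInd
    by_cases h : k + 1 ∣ t
    · simp only [uniformWord_eq_inl_iff, h]; simp
    · simp only [uniformWord_eq_inl_iff, h]; push_cast; simp; ring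

theorem prefixWeight_uniformWord_small (n k : ℕ) [NeZero n] (t : ℕ) :
    prefixWeight (colourSetInd (uniformWord n k) (smallColours n)) t = blockCount k t := by
  induction t with
  | zero => simp
  | succ t ih =>
    rw [prefixWeight_succ, ih, blockCount_succ]
    unfold colourSetInd uniformWord
    by_cases h : k + 1 ∣ t <;> simp [h]

theorem blockCount_mul (k q : ℕ) : blockCount k (q * (k + 1)) = q := by
  rw [blockCount_of_dvd (Dvd.intro_left q rfl), Nat.mul_div_cancel _ (Nat.succ_pos k)]

/-- The two colours alternate, so the arc difference is `0` or `-1` at a letter `i` and `0` or `1`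
at a letter `j`; one factor of each product vanishes. -/
theorem alternationExcess_uniformWord (n k m : ℕ) [NeZero n] {i j : Fin n} (hij : i ≠ j) (v : ℕ) :
    alternationExcess (m * n * (k + 1)) (colourInd (uniformWord n k) (.inr i))
      (colourInd (uniformWord n k) (.inr j)) v = 0 := by
  have hij' : (i : ℕ) ≠ j := fun h => hij (Fin.ext h)
  refine Finset.sum_eq_zero fun y _ => ?_
  have hD : arcWeight (m * n * (k + 1)) (colourInd (uniformWord n k) (.inr i)) v y
      - arcWeight (m * n * (k + 1)) (colourInd (uniformWord n k) (.inr j)) v y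
      = ((if (i : ℕ) < blockCount k y % n then 1 else 0)
          - (if (j : ℕ) < blockCount k y % n then 1 else 0))
        - ((if (i : ℕ) < blockCount k v % n then 1 else 0)
          - (if (j : ℕ) < blockCount k v % n then 1 else 0)) := by
    simp only [arcWeight, prefixWeight_uniformWord_inr, blockCount_mul, Nat.mul_mod_left,
      Nat.not_lt_zero, if_false]
    push_cast
    split_ifs <;> ring
  rw [hD]
  have hcol : ∀ l : Fin n, colourInd (uniformWord n k) (.inr l) y = 0 ∨
      blockCount k y % n = l := by
    intro l
    by_cases h : uniformWord n k y = .inr l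
    · right
      rw [uniformWord_eq_inr_iff] at h
      rw [blockCount_of_dvd h.1, h.2]
    · left; simp [colourInd, h]
  have h1 : colourInd (uniformWord n k) (.inr i) y *
      ((((if (i : ℕ) < blockCount k y % n then 1 else 0)
          - (if (j : ℕ) < blockCount k y % n then 1 else 0))
        - ((if (i : ℕ) < blockCount k v % n then 1 else 0)
          - (if (j : ℕ) < blockCount k v % n then 1 else 0))) *
      (((if (i : ℕ) < blockCount k y % n then 1 else 0)
          - (if (j : ℕ) < blockCount k y % n then 1 else 0))
        - ((if (i : ℕ) < blockCount k v % n then 1 else 0)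
          - (if (j : ℕ) < blockCount k v % n then 1 else 0)) + 1)) = 0 := by
    rcases hcol i with h | h
    · rw [h, zero_mul]
    · rw [h]
      split_ifs <;> first | omega | norm_num
  have h2 : colourInd (uniformWord n k) (.inr j) y *
      ((((if (i : ℕ) < blockCount k y % n then 1 else 0)
          - (if (j : ℕ) < blockCount k y % n then 1 else 0))
        - ((if (i : ℕ) < blockCount k v % n then 1 else 0)
          - (if (j : ℕ) < blockCount k v % n then 1 else 0))) *
      (((if (i : ℕ) < blockCount k y % n then 1 else 0)
          - (if (j : ℕ) < blockCount k y % n then 1 else 0))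
        - ((if (i : ℕ) < blockCount k v % n then 1 else 0)
          - (if (j : ℕ) < blockCount k v % n then 1 else 0)) - 1)) = 0 := by
    rcases hcol j with h | h
    · rw [h, zero_mul]
    · rw [h]
      split_ifs <;> first | omega | norm_num
  rw [h1, h2, add_zero]

theorem uniformityExcess_eq_zero {κ : Type*} [DecidableEq κ] {N : ℕ} {c : ℕ → κ} {k : ℚ} {a : κ}
    {S : Finset κ} (e : ℚ) (h : ∀ t, c t ∈ S →
      prefixWeight (colourInd c a) t - k * prefixWeight (colourSetInd c S) t = e) :
    uniformityExcess N c k a S = 0 := by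
  refine Finset.sum_eq_zero fun v _ => Finset.sum_eq_zero fun y _ => ?_
  by_cases hv : c v ∈ S
  · by_cases hy : c y ∈ S
    · rw [h v hv, h y hy]; simp
    · simp [colourSetInd, hy]
  · simp [colourSetInd, hv]

theorem uniformityExcess_uniformWord_small (n k N : ℕ) [NeZero n] {i j : Fin n} :
    uniformityExcess N (uniformWord n k) 1 (.inr i) {.inr j} = 0 := by
  -- Just before a letter `j`, colour `i` is ahead by one exactly when it precedes `j` within the
  -- period.
  refine uniformityExcess_eq_zero (if (i : ℕ) < j then 1 else 0) fun t ht => ?_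
  rw [Finset.mem_singleton, uniformWord_eq_inr_iff] at ht
  rw [prefixWeight_colourSetInd, Finset.sum_singleton, prefixWeight_uniformWord_inr,
    prefixWeight_uniformWord_inr, blockCount_of_dvd ht.1, ht.2]
  push_cast
  simp

theorem uniformityExcess_uniformWord_large (n k N : ℕ) [NeZero n] :
    uniformityExcess N (uniformWord n k) k (.inl 0) (smallColours n) = 0 := by
  refine uniformityExcess_eq_zero 0 fun t ht => ?_
  have hd : k + 1 ∣ t := by
    by_contra h
    rw [uniformWord_eq_inl_iff.2 h] at ht
    simp at ht
  rw [prefixWeight_uniformWord_inl, prefixWeight_uniformWord_small]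
  obtain ⟨q, rfl⟩ := hd
  rw [mul_comm (k + 1) q, blockCount_mul]
  push_cast
  ring

/-- The number of crossings of a word is bounded below by the value of the formula. -/
theorem le_card_crossingQuads {m n p : ℕ} (h : m * n ∣ p) (c : ℕ → Fin 1 ⊕ Fin n)
    (hP : prefixWeight (colourInd c (.inl 0)) (p + m * n) = p)
    (hQ : ∀ i, prefixWeight (colourInd c (.inr i)) (p + m * n) = m) :
    crossingPhi m n p - 1 / 12 * (m : ℚ) ^ 2 * (n : ℚ) ^ 2 + 1 / 12 * (p : ℚ) ^ 2
      ≤ ((crossingQuads (p + m * n) c).card : ℚ) := by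
  obtain ⟨k, hk⟩ := h
  obtain ⟨T, hT, hT0, -⟩ := two_mul_card_crossingQuads_eq (k := k)
    (by rw [hk]; push_cast; ring) rfl c hP hQ
  linarith

/-- Some word attains the value of the formula. -/
theorem exists_card_crossingQuads_eq {m n p : ℕ} (h : m * n ∣ p) :
    ∃ c : ℕ → Fin 1 ⊕ Fin n, prefixWeight (colourInd c (.inl 0)) (p + m * n) = p ∧
      (∀ i, prefixWeight (colourInd c (.inr i)) (p + m * n) = m) ∧
      ((crossingQuads (p + m * n) c).card : ℚ) =
        crossingPhi m n p - 1 / 12 * (m : ℚ) ^ 2 * (n : ℚ) ^ 2 + 1 / 12 * (p : ℚ) ^ 2 := by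
  obtain ⟨k, hk⟩ := h
  have hk' : (p : ℚ) = (k : ℚ) * (m * n) := by rw [hk]; push_cast; ring
  by_cases hmn : m * n = 0
  -- Zero divides only zero, so the graph has no vertices and every excess is an empty sum.
  · have hp : p = 0 := by rw [hk, hmn, zero_mul]
    have hN : p + m * n = 0 := by rw [hp, hmn]
    have hP : prefixWeight (colourInd (fun _ => (.inl 0 : Fin 1 ⊕ Fin n)) (.inl 0)) (p + m * n)
        = p := by rw [hN, hp]; simp
    have hQ : ∀ i, prefixWeight (colourInd (fun _ => (.inl 0 : Fin 1 ⊕ Fin n)) (.inr i))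
        (p + m * n) = m := by
      intro i
      have hm : m = 0 := (Nat.mul_eq_zero.1 hmn).resolve_right i.pos.ne'
      rw [hN, hm]; simp
    obtain ⟨T, hT, -, hT0⟩ := two_mul_card_crossingQuads_eq hk' rfl _ hP hQ
    refine ⟨_, hP, hQ, ?_⟩
    rw [hT0 (by simp [hN]) (by simp [hN, uniformityExcess]) (by simp [hN, uniformityExcess])] at hT
    linarith
  · have : NeZero n := ⟨fun h => hmn (by rw [h, mul_zero])⟩
    have hN : p + m * n = m * n * (k + 1) := by rw [hk]; ring
    have hP : prefixWeight (colourInd (uniformWord n k) (.inl 0)) (p + m * n) = p := by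
      rw [hN, prefixWeight_uniformWord_inl, blockCount_mul, hk]
      push_cast; ring
    have hQ : ∀ i, prefixWeight (colourInd (uniformWord n k) (.inr i)) (p + m * n) = m := by
      intro i
      rw [hN, prefixWeight_uniformWord_inr, blockCount_mul, Nat.mul_mod_left,
        Nat.mul_div_cancel _ (NeZero.pos n)]
      simp
    obtain ⟨T, hT, -, hT0⟩ := two_mul_card_crossingQuads_eq hk' rfl _ hP hQ
    refine ⟨_, hP, hQ, ?_⟩
    rw [hT0 (fun i j hij v _ => by rw [hN]; exact alternationExcess_uniformWord n k m hij v)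
      (fun i j _ => uniformityExcess_uniformWord_small n k _)
      (uniformityExcess_uniformWord_large n k _)] at hT
    linarith

/-! ### Chords of a convex polygon -/

/-- Twice the signed area of the triangle `p q r`. -/
def orientation (p q r : ℂ) : ℝ :=
  (q.re - p.re) * (r.im - p.im) - (q.im - p.im) * (r.re - p.re)

theorem orientation_rotate (p q r : ℂ) : orientation q r p = orientation p q r := by
  unfold orientation; ring

theorem orientation_eq_add {x y z : ℂ} {s t : ℝ} (hst : s + t = 1) (hz : s • x + t • y = z)
    (p q : ℂ) : orientation p q z = s * orientation p q x + t * orientation p q y := by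
  have hs : s = 1 - t := by linarith
  rw [← hz, hs]
  simp only [orientation, Complex.add_re, Complex.add_im, Complex.smul_re, Complex.smul_im,
    smul_eq_mul]
  ring

@[simp] theorem orientation_self_left (p q : ℂ) : orientation p q p = 0 := by
  unfold orientation; ring

@[simp] theorem orientation_self_right (p q : ℂ) : orientation p q q = 0 := by
  unfold orientation; ring

theorem orientation_of_mem_openSegment {p q z : ℂ} (h : z ∈ openSegment ℝ p q) :
    orientation p q z = 0 := by
  obtain ⟨s, t, -, -, hst, hz⟩ := h
  rw [orientation_eq_add hst hz]; simp

theorem notMem_openSegment_of_orientation_pos {p q r s z : ℂ} (hr : 0 < orientation p q r)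
    (hs : 0 < orientation p q s) (h : z ∈ openSegment ℝ p q) : z ∉ openSegment ℝ r s := by
  rintro ⟨a, b, ha, hb, hab, hz⟩
  have h0 := orientation_of_mem_openSegment h
  rw [orientation_eq_add hab hz] at h0
  nlinarith [mul_pos ha hr, mul_pos hb hs]

theorem notMem_openSegment_of_common_endpoint {p q r z : ℂ} (ho : orientation p q r ≠ 0)
    (h : z ∈ openSegment ℝ p q) : z ∉ openSegment ℝ p r := by
  rintro ⟨a, b, ha, hb, hab, hz⟩
  have h0 := orientation_of_mem_openSegment h
  rw [orientation_eq_add hab hz] at h0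
  simp [hb.ne', ho] at h0

theorem openSegment_inter_nonempty {p q r s : ℂ} (h₁ : 0 < orientation q r s)
    (h₂ : 0 < orientation p r s) (h₃ : 0 < orientation p q s) (h₄ : 0 < orientation p q r) :
    (openSegment ℝ p r ∩ openSegment ℝ q s).Nonempty := by
  have hsum : orientation q r s + orientation p q s = orientation p r s + orientation p q r := by
    unfold orientation; ring
  have hpos : 0 < orientation q r s + orientation p q s := by linarith
  have hpos' : 0 < orientation p r s + orientation p q r := by linarith
  set S := orientation q r s + orientation p q s with hS
  -- The weights come from the affine dependence of four points in the plane, whose coefficients are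
  -- the signed areas of the complementary triangles; `hsum` says that both sides have the same
  -- total.
  refine ⟨(orientation q r s / S) • p + (orientation p q s / S) • r,
    ⟨_, _, div_pos h₁ hpos, div_pos h₃ hpos, by rw [← add_div, div_self hpos.ne'], rfl⟩,
    ⟨orientation p r s / S, orientation p q r / S, div_pos h₂ hpos, div_pos h₄ hpos,
      by rw [← add_div, ← hsum, div_self hpos.ne'], ?_⟩⟩
  apply Complex.ext
  · simp only [Complex.add_re, Complex.smul_re, smul_eq_mul]
    rw [div_mul_eq_mul_div, div_mul_eq_mul_div, div_mul_eq_mul_div, div_mul_eq_mul_div, ← add_div,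
      ← add_div]
    congr 1
    unfold orientation; ring
  · simp only [Complex.add_im, Complex.smul_im, smul_eq_mul]
    rw [div_mul_eq_mul_div, div_mul_eq_mul_div, div_mul_eq_mul_div, div_mul_eq_mul_div, ← add_div,
      ← add_div]
    congr 1
    unfold orientation; ring

/-- The points `f` are the vertices of a convex polygon in counterclockwise order. -/
def ConvexPosition {N : ℕ} (f : Fin N → ℂ) : Prop :=
  ∀ i j k, i < j → j < k → 0 < orientation (f i) (f j) (f k)

theorem ConvexPosition.orientation_ne_zero {N : ℕ} {f : Fin N → ℂ} (hf : ConvexPosition f)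
    {i j k : Fin N} (hij : i ≠ j) (hik : i ≠ k) (hjk : j ≠ k) :
    orientation (f i) (f j) (f k) ≠ 0 := by
  have hswap : ∀ p q r : ℂ, orientation p r q = - orientation p q r := by
    intro p q r; unfold orientation; ring
  rcases lt_or_gt_of_ne hij with h1 | h1 <;> rcases lt_or_gt_of_ne hik with h2 | h2 <;>
    rcases lt_or_gt_of_ne hjk with h3 | h3
  · exact (hf _ _ _ h1 h3).ne'
  · rw [hswap]; exact neg_ne_zero.2 (hf _ _ _ h2 h3).ne'
  · exact absurd (h1.trans h3) h2.not_gt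
  · rw [orientation_rotate (f k)]; exact (hf _ _ _ h2 h1).ne'
  · rw [hswap, orientation_rotate (f j)]; exact neg_ne_zero.2 (hf _ _ _ h1 h2).ne'
  · exact absurd (h1.trans h2) h3.not_gt
  · rw [← orientation_rotate]; exact (hf _ _ _ h3 h2).ne'
  · rw [hswap, ← orientation_rotate]; exact neg_ne_zero.2 (hf _ _ _ h3 h1).ne'

/-- Two chords with a common interior point have no common endpoint, or coincide. -/
theorem ConvexPosition.endpoints_ne {N : ℕ} {f : Fin N → ℂ} (hf : ConvexPosition f)
    {a b c d : Fin N} (hab : a ≠ b) (hcd : c ≠ d) (hne : s(a, b) ≠ s(c, d)) {z : ℂ}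
    (h₁ : z ∈ openSegment ℝ (f a) (f b)) (h₂ : z ∈ openSegment ℝ (f c) (f d)) :
    a ≠ c ∧ a ≠ d ∧ b ≠ c ∧ b ≠ d := by
  refine ⟨?_, ?_, ?_, ?_⟩
  · rintro rfl
    have hbd : b ≠ d := by rintro rfl; exact hne rfl
    exact notMem_openSegment_of_common_endpoint (hf.orientation_ne_zero hab hcd hbd) h₁ h₂
  · rintro rfl
    have hbc : b ≠ c := by rintro rfl; exact hne Sym2.eq_swap
    rw [openSegment_symm] at h₂
    exact notMem_openSegment_of_common_endpoint (hf.orientation_ne_zero hab hcd.symm hbc) h₁ h₂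
  · rintro rfl
    have had : a ≠ d := by rintro rfl; exact hne Sym2.eq_swap
    rw [openSegment_symm] at h₁
    exact notMem_openSegment_of_common_endpoint (hf.orientation_ne_zero hab.symm hcd had) h₁ h₂
  · rintro rfl
    have hac : a ≠ c := by rintro rfl; exact hne rfl
    rw [openSegment_symm] at h₁ h₂
    exact notMem_openSegment_of_common_endpoint
      (hf.orientation_ne_zero hab.symm hcd.symm hac) h₁ h₂

/-- Chords with a common interior point alternate. -/
theorem ConvexPosition.alternate {N : ℕ} {f : Fin N → ℂ} (hf : ConvexPosition f)
    {a b c d : Fin N} (hab : a < b) (hcd : c < d) (hne : s(a, b) ≠ s(c, d)) (hac : a ≤ c)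
    (h : (openSegment ℝ (f a) (f b) ∩ openSegment ℝ (f c) (f d)).Nonempty) :
    a < c ∧ c < b ∧ b < d := by
  obtain ⟨z, h₁, h₂⟩ := h
  obtain ⟨n1, -, n3, n4⟩ := hf.endpoints_ne hab.ne hcd.ne hne h₁ h₂
  have hac' := lt_of_le_of_ne hac n1
  refine ⟨hac', ?_, ?_⟩
  -- If `b < c`, both ends of the second chord lie strictly on one side of the first.
  · by_contra hcb
    have hbc : b < c := lt_of_le_of_ne (not_lt.1 hcb) n3
    exact notMem_openSegment_of_orientation_pos (hf _ _ _ hab hbc) (hf _ _ _ hab (hbc.trans hcd))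
      h₁ h₂
  -- If `d < b`, the second chord lies strictly on the other side, which is the positive side after
  -- reversing the first.
  · by_contra hbd
    have hdb : d < b := lt_of_le_of_ne (not_lt.1 hbd) n4.symm
    rw [openSegment_symm] at h₁
    refine notMem_openSegment_of_orientation_pos ?_ ?_ h₁ h₂
    · rw [← orientation_rotate]; exact hf _ _ _ hac' (hcd.trans hdb)
    · rw [← orientation_rotate]; exact hf _ _ _ (hac'.trans hcd) hdb

/-! ### The crossings of a drawing in terms of the cyclic order -/

theorem crossings_eq_image {V : Type*} {G : SimpleGraph V} (D : OuterplanarDrawing G) {N : ℕ}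
    (e : Fin N ≃ V) (hf : ConvexPosition fun i => (D.pos (e i) : ℂ)) :
    D.crossings = (fun q : Fin N × Fin N × Fin N × Fin N =>
      s(s(e q.1, e q.2.2.1), s(e q.2.1, e q.2.2.2))) ''
      {q | q.1 < q.2.1 ∧ q.2.1 < q.2.2.1 ∧ q.2.2.1 < q.2.2.2 ∧ G.Adj (e q.1) (e q.2.2.1) ∧
        G.Adj (e q.2.1) (e q.2.2.2)} := by
  set I : Set (Sym2 (Sym2 V)) := (fun q : Fin N × Fin N × Fin N × Fin N =>
      s(s(e q.1, e q.2.2.1), s(e q.2.1, e q.2.2.2))) ''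
      {q | q.1 < q.2.1 ∧ q.2.1 < q.2.2.1 ∧ q.2.2.1 < q.2.2.2 ∧ G.Adj (e q.1) (e q.2.2.1) ∧
        G.Adj (e q.2.1) (e q.2.2.2)} with hI
  have hmem : ∀ a b c d : Fin N, a < b → c < d → G.Adj (e a) (e b) → G.Adj (e c) (e d) →
      s(e a, e b) ≠ s(e c, e d) →
      (openSegment ℝ (D.pos (e a) : ℂ) (D.pos (e b)) ∩
        openSegment ℝ (D.pos (e c) : ℂ) (D.pos (e d))).Nonempty →
      s(s(e a, e b), s(e c, e d)) ∈ I := by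
    intro a b c d hab hcd h1 h2 hne hz
    have hne' : s(a, b) ≠ s(c, d) := fun h => hne (by
      have := congrArg (Sym2.map e) h
      simpa using this)
    rcases le_total a c with hac | hca
    · obtain ⟨h3, h4, h5⟩ := hf.alternate hab hcd hne' hac hz
      exact ⟨(a, c, b, d), ⟨h3, h4, h5, h1, h2⟩, rfl⟩
    · rw [Set.inter_comm] at hz
      obtain ⟨h3, h4, h5⟩ := hf.alternate hcd hab hne'.symm hca hz
      exact ⟨(c, a, d, b), ⟨h3, h4, h5, h2, h1⟩, Sym2.eq_swap⟩
  apply Set.Subset.antisymm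
  · rintro _ ⟨u, v, x, y, huv, hxy, hne, hz, rfl⟩
    obtain ⟨a, rfl⟩ := e.surjective u
    obtain ⟨b, rfl⟩ := e.surjective v
    obtain ⟨c, rfl⟩ := e.surjective x
    obtain ⟨d, rfl⟩ := e.surjective y
    have hab : a ≠ b := by rintro rfl; exact G.loopless.irrefl _ huv
    have hcd : c ≠ d := by rintro rfl; exact G.loopless.irrefl _ hxy
    rcases lt_or_gt_of_ne hab with h1 | h1 <;> rcases lt_or_gt_of_ne hcd with h2 | h2
    · exact hmem a b c d h1 h2 huv hxy hne hz
    · rw [Sym2.eq_swap (a := e c)] at hne ⊢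
      rw [openSegment_symm ℝ (D.pos (e c) : ℂ)] at hz
      exact hmem a b d c h1 h2 huv hxy.symm hne hz
    · rw [Sym2.eq_swap (a := e a)] at hne ⊢
      rw [openSegment_symm ℝ (D.pos (e a) : ℂ)] at hz
      exact hmem b a c d h1 h2 huv.symm hxy hne hz
    · rw [Sym2.eq_swap (a := e a), Sym2.eq_swap (a := e c)] at hne ⊢
      rw [openSegment_symm ℝ (D.pos (e a) : ℂ), openSegment_symm ℝ (D.pos (e c) : ℂ)] at hz
      exact hmem b a d c h1 h2 huv.symm hxy.symm hne hz
  · rintro _ ⟨⟨i, j, k, l⟩, ⟨hij, hjk, hkl, h1, h2⟩, rfl⟩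
    simp only at hij hjk hkl h1 h2
    refine ⟨e i, e k, e j, e l, h1, h2, ?_, ?_, rfl⟩
    · intro h
      rw [Sym2.eq_iff] at h
      rcases h with ⟨h, -⟩ | ⟨h, -⟩
      · exact hij.ne (e.injective h)
      · exact (hij.trans (hjk.trans hkl)).ne (e.injective h)
    · exact openSegment_inter_nonempty (hf _ _ _ hjk hkl) (hf _ _ _ (hij.trans hjk) hkl)
        (hf _ _ _ hij (hjk.trans hkl)) (hf _ _ _ hij hjk)

theorem cr₁_eq_card_crossingQuads {V κ : Type*} [DecidableEq κ] {G : SimpleGraph V}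
    (D : OuterplanarDrawing G) {N : ℕ} (e : Fin N ≃ V)
    (hf : ConvexPosition fun i => (D.pos (e i) : ℂ)) (c : ℕ → κ)
    (hc : ∀ i j, G.Adj (e i) (e j) ↔ c i ≠ c j) :
    D.cr₁ = (crossingQuads N c).card := by
  rw [OuterplanarDrawing.cr₁, crossings_eq_image D e hf, Set.InjOn.ncard_image]
  · rw [← Set.ncard_coe_finset]
    refine Set.ncard_congr (fun q _ => ((q.1 : ℕ), (q.2.1 : ℕ), (q.2.2.1 : ℕ), (q.2.2.2 : ℕ)))
      ?_ ?_ ?_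
    · rintro ⟨i, j, k, l⟩ ⟨h1, h2, h3, h4, h5⟩
      simp only [hc] at h1 h2 h3 h4 h5
      simp [crossingQuads, h1, h2, h3, h4, h5]
    · rintro ⟨i, j, k, l⟩ ⟨i', j', k', l'⟩ - - h
      simpa [Fin.ext_iff] using h
    · rintro ⟨i, j, k, l⟩ h
      simp only [crossingQuads, Finset.coe_filter, Finset.mem_product, Finset.mem_range,
        Set.mem_ofPred_eq] at h
      obtain ⟨⟨hi, hj, hk, hl⟩, h1, h2, h3, h4, h5⟩ := h
      exact ⟨(⟨i, hi⟩, ⟨j, hj⟩, ⟨k, hk⟩, ⟨l, hl⟩),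
        ⟨h1, h2, h3, (hc _ _).2 h4, (hc _ _).2 h5⟩, rfl⟩
  -- The increasing order recovers the quadruple from the unordered pair of unordered pairs.
  · rintro ⟨i, j, k, l⟩ ⟨h1, h2, h3, -, -⟩ ⟨i', j', k', l'⟩ ⟨h1', h2', h3', -, -⟩ h
    simp only [Sym2.eq_iff, e.injective.eq_iff] at h h1 h2 h3 h1' h2' h3'
    simp only [Prod.mk.injEq]
    simp only [Fin.lt_def, Fin.ext_iff] at *
    omega

/-- The area of an inscribed triangle is a product of sines of half-differences of the angles, which
here lie strictly between `0` and `π`. -/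
theorem orientation_exp_pos {α β γ : ℝ} (hα : -Real.pi < α) (hαβ : α < β) (hβγ : β < γ)
    (hγ : γ ≤ Real.pi) :
    0 < orientation (Circle.exp α) (Circle.exp β) (Circle.exp γ) := by
  have key : orientation (Circle.exp α) (Circle.exp β) (Circle.exp γ)
      = 4 * (Real.sin ((β - α) / 2) * Real.sin ((γ - β) / 2) * Real.sin ((γ - α) / 2)) := by
    have h1 : orientation (Circle.exp α) (Circle.exp β) (Circle.exp γ)
        = Real.sin (β - α) + Real.sin (γ - β) - Real.sin (γ - α) := by
      simp only [orientation, Circle.coe_exp, Complex.exp_ofReal_mul_I_re,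
        Complex.exp_ofReal_mul_I_im, Real.sin_sub]
      ring
    have h2 : ∀ x y : ℝ, Real.sin (2 * x) + Real.sin (2 * y) - Real.sin (2 * (x + y))
        = 4 * (Real.sin x * Real.sin y * Real.sin (x + y)) := by
      intro x y
      rw [mul_add, Real.sin_add, Real.sin_add, Real.sin_two_mul, Real.sin_two_mul,
        Real.cos_two_mul', Real.cos_two_mul']
      linear_combination (-2 * Real.sin x * Real.cos x) * Real.sin_sq_add_cos_sq y
        - 2 * Real.sin y * Real.cos y * Real.sin_sq_add_cos_sq x
    have h3 := h2 ((β - α) / 2) ((γ - β) / 2)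
    rw [show (β - α) / 2 + (γ - β) / 2 = (γ - α) / 2 by ring, mul_div_cancel₀ _ two_ne_zero,
      mul_div_cancel₀ _ two_ne_zero, mul_div_cancel₀ _ two_ne_zero] at h3
    rw [h1, h3]
  rw [key]
  have p1 : 0 < Real.sin ((β - α) / 2) := Real.sin_pos_of_pos_of_lt_pi (by linarith) (by linarith)
  have p2 : 0 < Real.sin ((γ - β) / 2) := Real.sin_pos_of_pos_of_lt_pi (by linarith) (by linarith)
  have p3 : 0 < Real.sin ((γ - α) / 2) := Real.sin_pos_of_pos_of_lt_pi (by linarith) (by linarith)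
  positivity

/-! ### Points of the circle in general position -/

/-- The point of the circle with stereographic parameter `t`. -/
noncomputable def circlePoint (t : ℝ) : Circle :=
  ⟨⟨(1 - t ^ 2) / (1 + t ^ 2), 2 * t / (1 + t ^ 2)⟩, by
    have h : 1 + t ^ 2 ≠ 0 := by positivity
    change _ ∈ Metric.sphere (0 : ℂ) 1
    rw [mem_sphere_zero_iff_norm, ← sq_eq_sq₀ (norm_nonneg _) zero_le_one, Complex.sq_norm,
      Complex.normSq_mk]
    field_simp
    ring⟩

theorem circlePoint_re (t : ℝ) : (circlePoint t : ℂ).re = (1 - t ^ 2) / (1 + t ^ 2) := rfl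

theorem circlePoint_im (t : ℝ) : (circlePoint t : ℂ).im = 2 * t / (1 + t ^ 2) := rfl

theorem orientation_circlePoint_pos {a b c : ℝ} (hab : a < b) (hbc : b < c) :
    0 < orientation (circlePoint a) (circlePoint b) (circlePoint c) := by
  have ha : 1 + a ^ 2 ≠ 0 := by positivity
  have hb : 1 + b ^ 2 ≠ 0 := by positivity
  have hc : 1 + c ^ 2 ≠ 0 := by positivity
  have : orientation (circlePoint a) (circlePoint b) (circlePoint c)
      = 4 * ((b - a) * (c - b) * (c - a)) / ((1 + a ^ 2) * (1 + b ^ 2) * (1 + c ^ 2)) := by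
    simp only [orientation, circlePoint_re, circlePoint_im]
    field_simp
    ring
  rw [this]
  have h1 := sub_pos.2 hab
  have h2 := sub_pos.2 hbc
  have h3 := sub_pos.2 (hab.trans hbc)
  positivity

/-- The line through the points with parameters `a` and `b`. -/
theorem chord_equation {a b : ℝ} {z : ℂ}
    (h : z ∈ openSegment ℝ (circlePoint a : ℂ) (circlePoint b)) :
    (z.re - 1) + (a + b) * z.im - a * b * (z.re + 1) = 0 := by
  obtain ⟨s, t, -, -, hst, rfl⟩ := h
  have ha : 1 + a ^ 2 ≠ 0 := by positivity
  have hb : 1 + b ^ 2 ≠ 0 := by positivity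
  have hs : s = 1 - t := by linarith
  simp only [Complex.add_re, Complex.add_im, Complex.smul_re, Complex.smul_im, smul_eq_mul,
    circlePoint_re, circlePoint_im, hs]
  field_simp
  ring

/-- The determinant whose vanishing expresses that three chords are concurrent or parallel. -/
def concurrencyDet (a b c d e f : ℝ) : ℝ :=
  ((c + d) * (e * f) - (e + f) * (c * d)) - ((a + b) * (e * f) - (e + f) * (a * b))
    + ((a + b) * (c * d) - (c + d) * (a * b))

/-- The three chord equations are linear in `(X - 1, Y, X + 1)`. Eliminating `Y` shows that the
determinant kills both `X - 1` and `X + 1`, which differ by 2. -/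
theorem concurrencyDet_eq_zero {a b c d e f : ℝ} {z : ℂ}
    (h₁ : z ∈ openSegment ℝ (circlePoint a : ℂ) (circlePoint b))
    (h₂ : z ∈ openSegment ℝ (circlePoint c : ℂ) (circlePoint d))
    (h₃ : z ∈ openSegment ℝ (circlePoint e : ℂ) (circlePoint f)) :
    concurrencyDet a b c d e f = 0 := by
  have e1 := chord_equation h₁
  have e2 := chord_equation h₂
  have e3 := chord_equation h₃
  generalize z.re = X at *
  generalize z.im = Y at *
  unfold concurrencyDet
  have hu : ((c + d) * (e * f) - (e + f) * (c * d) - ((a + b) * (e * f) - (e + f) * (a * b))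
    + ((a + b) * (c * d) - (c + d) * (a * b))) * (X - 1) = 0 := by
    linear_combination ((c + d) * (e * f) - (e + f) * (c * d)) * e1
      - ((a + b) * (e * f) - (e + f) * (a * b)) * e2
      + ((a + b) * (c * d) - (c + d) * (a * b)) * e3
  have hv : ((c + d) * (e * f) - (e + f) * (c * d) - ((a + b) * (e * f) - (e + f) * (a * b))
    + ((a + b) * (c * d) - (c + d) * (a * b))) * (X + 1) = 0 := by
    linear_combination (-((e + f) - (c + d))) * e1 + ((e + f) - (a + b)) * e2
      - ((c + d) - (a + b)) * e3
  linarith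

/-- The determinant is affine in `x` and nonzero at `x = c`, where the first two chords meet on the
circle at a point off the third; hence at most one `x` is bad. -/
theorem eventually_concurrencyDet_ne_zero {b c d e f : ℝ} (hbd : b ≠ d) (hce : c ≠ e)
    (hcf : c ≠ f) : ∀ᶠ x in Filter.atTop, concurrencyDet x b c d e f ≠ 0 := by
  have h0 : concurrencyDet c b c d e f ≠ 0 := by
    have : concurrencyDet c b c d e f = - ((b - d) * ((c - e) * (c - f))) := by
      unfold concurrencyDet; ring
    rw [this]
    exact neg_ne_zero.2 (mul_ne_zero (sub_ne_zero.2 hbd)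
      (mul_ne_zero (sub_ne_zero.2 hce) (sub_ne_zero.2 hcf)))
  have hlin : ∀ x y, x ≠ y → concurrencyDet x b c d e f = 0 → concurrencyDet y b c d e f = 0 →
      concurrencyDet c b c d e f = 0 := by
    intro x y hxy hx hy
    have : (x - y) * concurrencyDet c b c d e f = 0 := by
      have : (x - y) * concurrencyDet c b c d e f
          = (c - y) * concurrencyDet x b c d e f - (c - x) * concurrencyDet y b c d e f := by
        unfold concurrencyDet; ring
      rw [this, hx, hy]; ring
    exact (mul_eq_zero.1 this).resolve_left (sub_ne_zero.2 hxy)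
  have hsub : {x | concurrencyDet x b c d e f = 0}.Subsingleton := by
    intro x hx y hy
    by_contra hxy
    exact h0 (hlin x y hxy hx hy)
  exact Filter.atTop_le_cofinite hsub.finite.compl_mem_cofinite

/-- No three chords with distinct endpoints among the first `N` parameters are concurrent. -/
def GenericParameters (N : ℕ) (t : ℕ → ℝ) : Prop :=
  (∀ i j, i < j → j < N → t i < t j) ∧
    ∀ a b c d e f, a < N → b < N → c < N → d < N → e < N → f < N → [a, b, c, d, e, f].Nodup →
      concurrencyDet (t a) (t b) (t c) (t d) (t e) (t f) ≠ 0

theorem concurrencyDet_swap (a b c d e f : ℝ) :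
    concurrencyDet b a c d e f = concurrencyDet a b c d e f := by unfold concurrencyDet; ring

theorem concurrencyDet_swap_rows (a b c d e f : ℝ) :
    concurrencyDet c d a b e f = - concurrencyDet a b c d e f := by unfold concurrencyDet; ring

theorem concurrencyDet_swap_rows' (a b c d e f : ℝ) :
    concurrencyDet e f c d a b = - concurrencyDet a b c d e f := by unfold concurrencyDet; ring

/-- Points are added one at a time, each with a parameter so large that it exceeds the earlier ones
and avoids the finitely many bad values. The symmetries of the determinant move the new point to the
first slot. -/
theorem exists_genericParameters (N : ℕ) : ∃ t, GenericParameters N t := by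
  induction N with
  | zero => exact ⟨fun _ => 0, by intro i j _ h; omega, by intro a _ _ _ _ _ h; omega⟩
  | succ N ih =>
    obtain ⟨t, ht, hgen⟩ := ih
    have hinj : ∀ i j, i < N → j < N → i ≠ j → t i ≠ t j := by
      intro i j hi hj hij
      rcases lt_or_gt_of_ne hij with h | h
      · exact (ht i j h hj).ne
      · exact (ht j i h hi).ne'
    have h1 : ∀ᶠ x in Filter.atTop, ∀ i ∈ Set.Iio N, t i < x :=
      (Filter.eventually_all_finite (Set.finite_Iio N)).2 fun i _ => Filter.eventually_gt_atTop _
    have h2 : ∀ᶠ x in Filter.atTop, ∀ b ∈ Set.Iio N, ∀ c ∈ Set.Iio N, ∀ d ∈ Set.Iio N,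
        ∀ e ∈ Set.Iio N, ∀ f ∈ Set.Iio N, [b, c, d, e, f].Nodup →
        concurrencyDet x (t b) (t c) (t d) (t e) (t f) ≠ 0 := by
      refine (Filter.eventually_all_finite (Set.finite_Iio N)).2 fun b hb => ?_
      refine (Filter.eventually_all_finite (Set.finite_Iio N)).2 fun c hc => ?_
      refine (Filter.eventually_all_finite (Set.finite_Iio N)).2 fun d hd => ?_
      refine (Filter.eventually_all_finite (Set.finite_Iio N)).2 fun e he => ?_
      refine (Filter.eventually_all_finite (Set.finite_Iio N)).2 fun f hf => ?_
      by_cases hnd : [b, c, d, e, f].Nodup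
      · have hnd' := hnd
        simp only [List.nodup_cons, List.mem_cons, List.not_mem_nil, not_or, or_false] at hnd'
        filter_upwards [eventually_concurrencyDet_ne_zero (hinj b d hb hd (by tauto))
          (hinj c e hc he (by tauto)) (hinj c f hc hf (by tauto))] with x hx _ using hx
      · exact Filter.Eventually.of_forall fun x h => absurd h hnd
    obtain ⟨x, hx1, hx2⟩ := (h1.and h2).exists
    simp only [Set.mem_Iio] at hx1 hx2
    refine ⟨fun i => if i < N then t i else x, ?_, ?_⟩
    · intro i j hij hj
      have hi : i < N := by omega
      by_cases hjN : j < N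
      · simp only [hi, hjN, if_true]; exact ht i j hij hjN
      · simp only [hi, hjN, if_true, if_false]; exact hx1 i hi
    · intro a b c d e f ha hb hc hd he hf hnd
      simp only [List.nodup_cons, List.mem_cons, List.not_mem_nil, not_or, or_false,
        List.nodup_nil, not_false_eq_true, and_true] at hnd hgen hx2
      have hlt : ∀ i, i < N + 1 → i ≠ N → i < N := fun i h h' => by omega
      by_cases haN : a = N
      · have hb' := hlt b hb (by omega)
        have hc' := hlt c hc (by omega)
        have hd' := hlt d hd (by omega)
        have he' := hlt e he (by omega)
        have hf' := hlt f hf (by omega)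
        simp only [haN, hb', hc', hd', he', hf', lt_irrefl, if_true, if_false]
        exact hx2 b hb' c hc' d hd' e he' f hf' (by tauto)
      have ha' := hlt a ha haN
      by_cases hbN : b = N
      · have hc' := hlt c hc (by omega)
        have hd' := hlt d hd (by omega)
        have he' := hlt e he (by omega)
        have hf' := hlt f hf (by omega)
        simp only [hbN, ha', hc', hd', he', hf', lt_irrefl, if_true, if_false]
        rw [concurrencyDet_swap]
        exact hx2 a ha' c hc' d hd' e he' f hf' (by tauto)
      have hb' := hlt b hb hbN
      by_cases hcN : c = N
      · have hd' := hlt d hd (by omega)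
        have he' := hlt e he (by omega)
        have hf' := hlt f hf (by omega)
        simp only [hcN, ha', hb', hd', he', hf', lt_irrefl, if_true, if_false]
        rw [concurrencyDet_swap_rows]
        exact neg_ne_zero.2 (hx2 d hd' a ha' b hb' e he' f hf' (by grind))
      have hc' := hlt c hc hcN
      by_cases hdN : d = N
      · have he' := hlt e he (by omega)
        have hf' := hlt f hf (by omega)
        simp only [hdN, ha', hb', hc', he', hf', lt_irrefl, if_true, if_false]
        rw [concurrencyDet_swap_rows, concurrencyDet_swap]
        exact neg_ne_zero.2 (hx2 c hc' a ha' b hb' e he' f hf' (by grind))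
      have hd' := hlt d hd hdN
      by_cases heN : e = N
      · have hf' := hlt f hf (by omega)
        simp only [heN, ha', hb', hc', hd', hf', lt_irrefl, if_true, if_false]
        rw [concurrencyDet_swap_rows']
        exact neg_ne_zero.2 (hx2 f hf' c hc' d hd' a ha' b hb' (by grind))
      have he' := hlt e he heN
      by_cases hfN : f = N
      · simp only [hfN, ha', hb', hc', hd', he', lt_irrefl, if_true, if_false]
        rw [concurrencyDet_swap_rows', concurrencyDet_swap]
        exact neg_ne_zero.2 (hx2 e he' c hc' d hd' a ha' b hb' (by grind))
      have hf' := hlt f hf hfN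
      simp only [ha', hb', hc', hd', he', hf', if_true]
      exact hgen a b c d e f ha' hb' hc' hd' he' hf' hnd

/-- Every enumeration of the vertices is the counterclockwise order of some drawing. -/
theorem exists_drawing_of_enumeration {V : Type*} (G : SimpleGraph V) {N : ℕ} (e : Fin N ≃ V) :
    ∃ D : OuterplanarDrawing G, ConvexPosition fun i => (D.pos (e i) : ℂ) := by
  obtain ⟨t, ht, hgen⟩ := exists_genericParameters N
  have hconv : ConvexPosition fun i : Fin N => (circlePoint (t i) : ℂ) :=
    fun i j k hij hjk => orientation_circlePoint_pos (ht i j hij j.isLt) (ht j k hjk k.isLt)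
  have hinj : Function.Injective fun v => circlePoint (t (e.symm v)) := by
    intro u v huv
    by_contra hne
    have him := congrArg (fun z : Circle => (z : ℂ).im) huv
    have hre := congrArg (fun z : Circle => (z : ℂ).re) huv
    simp only [circlePoint_im, circlePoint_re] at him hre
    have htne : t (e.symm u) ≠ t (e.symm v) := by
      have : e.symm u ≠ e.symm v := fun h => hne (e.symm.injective h)
      rcases lt_or_gt_of_ne this with h | h
      · exact (ht _ _ h (Fin.isLt _)).ne
      · exact (ht _ _ h (Fin.isLt _)).ne'
    generalize t (e.symm u) = a at *
    generalize t (e.symm v) = b at *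
    have ha : 1 + a ^ 2 ≠ 0 := by positivity
    have hb : 1 + b ^ 2 ≠ 0 := by positivity
    rw [div_eq_div_iff ha hb] at him hre
    have h1 : a ^ 2 = b ^ 2 := by linarith
    rw [h1] at him
    have h2 : 2 * a = 2 * b := mul_right_cancel₀ hb him
    exact htne (by linarith)
  refine ⟨⟨fun v => circlePoint (t (e.symm v)), hinj, ?_⟩, ?_⟩
  · intro u₁ v₁ u₂ v₂ u₃ v₃ a₁ a₂ a₃ n₁₂ n₁₃ n₂₃ z h₁ h₂ h₃
    have hne : ∀ {u v}, G.Adj u v → e.symm u ≠ e.symm v :=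
      fun h h' => h.ne (e.symm.injective h')
    have hne' : ∀ {u v x y : V}, s(u, v) ≠ s(x, y) →
        s(e.symm u, e.symm v) ≠ s(e.symm x, e.symm y) := by
      intro u v x y h h'
      have := congrArg (Sym2.map e) h'
      exact h (by simpa using this)
    -- Concurrent edges have six distinct endpoints, which is the situation excluded by genericity.
    have p₁₂ := hconv.endpoints_ne (hne a₁) (hne a₂) (hne' n₁₂) h₁ h₂
    have p₁₃ := hconv.endpoints_ne (hne a₁) (hne a₃) (hne' n₁₃) h₁ h₃
    have p₂₃ := hconv.endpoints_ne (hne a₂) (hne a₃) (hne' n₂₃) h₂ h₃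
    have q₁ := hne a₁
    have q₂ := hne a₂
    have q₃ := hne a₃
    refine hgen _ _ _ _ _ _ (Fin.isLt _) (Fin.isLt _) (Fin.isLt _) (Fin.isLt _) (Fin.isLt _)
      (Fin.isLt _) ?_ (concurrencyDet_eq_zero h₁ h₂ h₃)
    simp only [ne_eq, Fin.ext_iff] at p₁₂ p₁₃ p₂₃ q₁ q₂ q₃
    simp only [List.nodup_cons, List.mem_cons, List.not_mem_nil, not_or, or_false,
        List.nodup_nil, not_false_eq_true, and_true]
    tauto
  · simpa using hconv

/-- The vertices of a drawing can be enumerated in counterclockwise order. -/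
theorem exists_enumeration_of_drawing {V : Type*} [Fintype V] {G : SimpleGraph V}
    (D : OuterplanarDrawing G) {N : ℕ} (hN : Fintype.card V = N) :
    ∃ e : Fin N ≃ V, ConvexPosition fun i => (D.pos (e i) : ℂ) := by
  -- Sorting by argument in `(-π, π]` cuts the circle at `-1` and reads it counterclockwise.
  let f : V → ℝ := fun v => Complex.arg (D.pos v)
  have hf : Function.Injective f := Circle.injective_arg.comp D.pos_injective
  let _ : LinearOrder V := LinearOrder.lift' f hf
  refine ⟨(Fintype.orderIsoFinOfCardEq V hN).toEquiv, fun i j k hij hjk => ?_⟩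
  have hlt : ∀ i j : Fin N, i < j → f (Fintype.orderIsoFinOfCardEq V hN i) <
      f (Fintype.orderIsoFinOfCardEq V hN j) :=
    fun i j h => (Fintype.orderIsoFinOfCardEq V hN).lt_iff_lt.2 h
  have hexp : ∀ v : V, D.pos v = Circle.exp (f v) := fun v => (Circle.exp_arg _).symm
  simp only [hexp]
  exact orientation_exp_pos (Complex.neg_pi_lt_arg _) (hlt i j hij) (hlt j k hjk)
    (Complex.arg_le_pi _)

/-! ### The outerplanar crossing number -/

theorem prefixWeight_colourInd_eq_card {κ : Type*} [DecidableEq κ] {N : ℕ} (c : ℕ → κ) (a : κ) :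
    prefixWeight (colourInd c a) N = (Fintype.card {i : Fin N // c i = a} : ℚ) := by
  rw [Fintype.card_subtype, prefixWeight, Finset.sum_range, Finset.card_filter]
  push_cast
  rfl

/-- The size of a class of `multipartiteK p 1 m n`. -/
abbrev classSize (p m : ℕ) {n : ℕ} (a : Fin 1 ⊕ Fin n) : ℕ :=
  Sum.elim (fun _ => p) (fun _ => m) a

theorem card_multipartite (m n p : ℕ) :
    Fintype.card (Σ i : Fin 1 ⊕ Fin n, Fin (Sum.elim (fun _ => p) (fun _ => m) i))
      = p + m * n := by
  simp [Fintype.card_sigma, mul_comm]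

/-- The word of classes along an enumeration of the vertices. -/
theorem prefixWeight_of_enumeration {m n p N : ℕ}
    (e : Fin N ≃ Σ i : Fin 1 ⊕ Fin n, Fin (Sum.elim (fun _ => p) (fun _ => m) i))
    {c : ℕ → Fin 1 ⊕ Fin n} (hc : ∀ i : Fin N, c i = (e i).1) (a : Fin 1 ⊕ Fin n) :
    prefixWeight (colourInd c a) N = classSize p m a := by
  rw [prefixWeight_colourInd_eq_card]
  congr 1
  let e₁ : {i : Fin N // c i = a} ≃
      {v : Σ i : Fin 1 ⊕ Fin n, Fin (Sum.elim (fun _ => p) (fun _ => m) i) // v.1 = a} :=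
    e.subtypeEquiv fun i => by rw [hc]
  rw [Fintype.card_congr (e₁.trans (Equiv.sigmaSubtype a)), Fintype.card_fin]

theorem exists_enumeration_of_word {m n p N : ℕ} {c : ℕ → Fin 1 ⊕ Fin n}
    (hc : ∀ a, prefixWeight (colourInd c a) N = classSize p m a) :
    ∃ e : Fin N ≃ Σ i : Fin 1 ⊕ Fin n, Fin (Sum.elim (fun _ => p) (fun _ => m) i),
      ∀ i : Fin N, c i = (e i).1 := by
  have hcard : ∀ a, Fintype.card {i : Fin N // c i = a} = classSize p m a := by
    intro a
    have := hc a
    rw [prefixWeight_colourInd_eq_card] at this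
    exact_mod_cast this
  exact ⟨(Equiv.sigmaFiberEquiv fun i : Fin N => c i).symm.trans
    (Equiv.sigmaCongrRight fun a => Fintype.equivFinOfCardEq (hcard a)), fun i => rfl⟩

theorem multipartiteK_adj {m n p N : ℕ}
    (e : Fin N ≃ Σ i : Fin 1 ⊕ Fin n, Fin (Sum.elim (fun _ => p) (fun _ => m) i))
    {c : ℕ → Fin 1 ⊕ Fin n} (hc : ∀ i : Fin N, c i = (e i).1) (i j : Fin N) :
    (multipartiteK p 1 m n).Adj (e i) (e j) ↔ c i ≠ c j := by
  rw [hc, hc]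
  exact Iff.rfl

theorem le_cr₁ {m n p : ℕ} (h : m * n ∣ p) (D : OuterplanarDrawing (multipartiteK p 1 m n)) :
    crossingPhi m n p - 1 / 12 * (m : ℚ) ^ 2 * (n : ℚ) ^ 2 + 1 / 12 * (p : ℚ) ^ 2
      ≤ (D.cr₁ : ℚ) := by
  obtain ⟨e, he⟩ := exists_enumeration_of_drawing D (card_multipartite m n p)
  let c : ℕ → Fin 1 ⊕ Fin n := fun t => if h : t < p + m * n then (e ⟨t, h⟩).1 else .inl 0
  have hc : ∀ i : Fin (p + m * n), c i = (e i).1 := fun i => by simp [c]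
  rw [cr₁_eq_card_crossingQuads D e he c (multipartiteK_adj e hc)]
  exact le_card_crossingQuads h c (prefixWeight_of_enumeration e hc _)
    fun i => prefixWeight_of_enumeration e hc _

theorem exists_cr₁_eq {m n p : ℕ} (h : m * n ∣ p) :
    ∃ D : OuterplanarDrawing (multipartiteK p 1 m n), (D.cr₁ : ℚ) =
      crossingPhi m n p - 1 / 12 * (m : ℚ) ^ 2 * (n : ℚ) ^ 2 + 1 / 12 * (p : ℚ) ^ 2 := by
  obtain ⟨c, hP, hQ, hcard⟩ := exists_card_crossingQuads_eq h
  obtain ⟨e, hc⟩ := exists_enumeration_of_word (m := m) (n := n) (p := p) (N := p + m * n) (c := c)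
    (by
      rintro (a | a)
      · rw [Subsingleton.elim a 0]; exact hP
      · exact hQ a)
  obtain ⟨D, hD⟩ := exists_drawing_of_enumeration (multipartiteK p 1 m n) e
  exact ⟨D, by rw [cr₁_eq_card_crossingQuads D e hD c (multipartiteK_adj e hc), hcard]⟩

theorem theorem2 (m n p : ℕ) (h : m * n ∣ p) :
    IsLeast (Set.range fun D : OuterplanarDrawing (multipartiteK p 1 m n) => D.cr₁)
      (outerplanarCrossingNumber (multipartiteK p 1 m n)) ∧
    (outerplanarCrossingNumber (multipartiteK p 1 m n) : ℚ) =
      crossingPhi m n p - 1 / 12 * (m : ℚ) ^ 2 * (n : ℚ) ^ 2 + 1 / 12 * (p : ℚ) ^ 2 := by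
  obtain ⟨D, hD⟩ := exists_cr₁_eq h
  have hmem : outerplanarCrossingNumber (multipartiteK p 1 m n) ∈
      Set.range fun D : OuterplanarDrawing (multipartiteK p 1 m n) => D.cr₁ :=
    -- The optimal drawing makes the set of crossing counts nonempty, so its infimum is attained and
    -- is not the default value `0` of an empty infimum.
    Nat.sInf_mem ⟨_, D, rfl⟩
  refine ⟨⟨hmem, fun _ hx => Nat.sInf_le hx⟩, le_antisymm ?_ ?_⟩
  · have hle : outerplanarCrossingNumber (multipartiteK p 1 m n) ≤ D.cr₁ :=
      Nat.sInf_le (Set.mem_range_self D)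
    rw [← hD]
    exact_mod_cast hle
  · obtain ⟨D', hD'⟩ := hmem
    rw [← hD']
    exact le_cr₁ h D'
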